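/- Let $\{\mathsf s_i\}$ be a stationary first-order Markov chain on a discrete (countable) alphabet $\mathcal S$, with marginal law $p_{\mathsf s}$ of finite entropy $H(\mathsf s)$ and transition law $p_1(\cdot\mid\cdot)$; logarithms are to base $2$. Fix integers $B,W\ge 0$. For a horizon $\mathcal L\ge 0$ and a block length $n$, source vectors $\mathsf s_{-1}^n,\mathsf s_0^n,\dots,\mathsf s_{\mathcal L}^n$ are generated as follows: $\mathsf s_{-1}^n$ is i.i.d. from $p_{\mathsf s}$, and given the past, $\mathsf s_i^n$ has law $\prod_{k=1}^n p_1(\cdot\mid s_{i-1,k})$. A rate-$R$ encoder sends at each time $0\le i\le\mathcal L$ an index $\mathsf f_i=\mathcal F_i(\mathsf s_{-1}^n,\dots,\mathsf s_i^n)\in\{1,\dots,\lfloor 2^{nR}\rfloor\}$. The channel erases a burst: for some $j\ge 0$ and some $0\le B'\le B$, $\mathsf g_i=\star$ for $j\le i\le j+B'-1$ and $\mathsf g_i=\mathsf f_i$ otherwise. The decoder outputs $\hat{\mathsf s}_i^n=\mathcal G_i(\mathsf g_0,\dots,\mathsf g_i,\mathsf s_{-1}^n)$, with no delay. The rate $R$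 is feasible for the horizon $\mathcal L$ if there are encoders and decoders for every $n$ and a sequence $\epsilon_n\to0$ such that $\Pr(\hat{\mathsf s}_i^n\ne \mathsf s_i^n)\le\epsilon_n$ for all such $j$, $B'$ and all $i\in\{0,\dots,\mathcal L\}\setminus\{j,\dots,j+B'+W-1\}$. Let $R_{\mathcal L}(B,W)$ be the infimum of the feasible rates and $R(B,W)=\lim_{\mathcal L\to\infty}R_{\mathcal L}(B,W)$ the lossless rate-recovery function. **Theorem.** The limit $R(B,W)$ exists, and $$H(\mathsf s_1|\mathsf s_0)+\frac{1}{W+1}I(\mathsf s_B;\mathsf s_{B+W+1}|\mathsf s_0)\;\le\; R(B,W)\;\le\; H(\mathsf s_1|\mathsf s_0)+\frac{1}{W+1}I(\mathsf s_B;\mathsf s_{B+1}|\mathsf s_0).$$ -/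

import Mathlib

open Filter Topology
open scoped ENNReal NNReal

namespace BurstStreaming

noncomputable section

/-! ### Entropies, in bits -/

/-- The entropy `H(p) = ∑ p(x) log₂ (1 / p(x))` is finite. -/
def FiniteEntropy {A : Type*} (p : PMF A) : Prop :=
  Summable fun a => (p a).toReal * Real.logb 2 (1 / (p a).toReal)

/-- Conditional entropy `H(X | Z) = ∑ p(x,z) log₂ (p(z) / p(x,z))` of the discrete random variables
`X`, `Z` on the discrete probability space `(Ω, μ)`.  All terms are non-negative. -/
def condEntropy {Ω A C : Type*} (μ : PMF Ω) (X : Ω → A) (Z : Ω → C) : ℝ :=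
  ∑' a : A × C, (μ.map (fun ω => (X ω, Z ω)) a).toReal *
    Real.logb 2 ((μ.map Z a.2).toReal / (μ.map (fun ω => (X ω, Z ω)) a).toReal)

/-- Conditional mutual information `I(X ; Y | Z) = H(X | Z) - H(X | Y, Z)`. -/
def condMutualInfo {Ω A B C : Type*} (μ : PMF Ω) (X : Ω → A) (Y : Ω → B) (Z : Ω → C) : ℝ :=
  condEntropy μ X Z - condEntropy μ X (fun ω => (Y ω, Z ω))

/-! ### The source -/

theorem tsum_prod_eq_one {A : Type*} :
    ∀ (n : ℕ) (q : Fin n → PMF A), ∑' x : Fin n → A, ∏ k, q k (x k) = 1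
  | 0, q => by simp
  | n + 1, q => by
    rw [← (Fin.consEquiv fun _ : Fin (n + 1) => A).tsum_eq]
    rw [ENNReal.tsum_prod']
    simp only [Fin.consEquiv_apply, Fin.prod_univ_succ, Fin.cons_zero, Fin.cons_succ,
      ENNReal.tsum_mul_left]
    rw [tsum_prod_eq_one n fun k => q k.succ]
    simp [PMF.tsum_coe]

/-- The law of a vector of length `n` with independent entries, the `k`-th one with law `q k`. -/
def prodLaw {A : Type*} {n : ℕ} (q : Fin n → PMF A) : PMF (Fin n → A) :=
  ⟨fun x => ∏ k, q k (x k), by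
    rw [← tsum_prod_eq_one n q]; exact ENNReal.summable.hasSum⟩

theorem tsum_chain_eq_one {A : Type*} (p : PMF A) (κ : A → PMF A) :
    ∀ m : ℕ, ∑' x : Fin (m + 1) → A, p (x 0) * ∏ i : Fin m, κ (x i.castSucc) (x i.succ) = 1
  | 0 => by
    rw [← (Equiv.funUnique (Fin 1) A).symm.tsum_eq]
    simp [PMF.tsum_coe]
  | m + 1 => by
    rw [← (Fin.snocEquiv fun _ : Fin (m + 2) => A).tsum_eq, ← (Equiv.prodComm _ _).tsum_eq,
      ENNReal.tsum_prod', ← tsum_chain_eq_one p κ m]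
    refine tsum_congr fun x => ?_
    have h0 : ∀ a : A, (Fin.snoc x a : Fin (m + 2) → A) 0 = x 0 := fun a =>
      Fin.snoc_castSucc (α := fun _ => A) a x 0
    have h1 : ∀ (a : A) (i : Fin m),
        (Fin.snoc x a : Fin (m + 2) → A) i.castSucc.succ = x i.succ := fun a i =>
      Fin.snoc_castSucc (α := fun _ => A) a x i.succ
    have h2 : ∀ a : A, (Fin.snoc x a : Fin (m + 2) → A) (Fin.last m).succ = a := fun a =>
      Fin.snoc_last (α := fun _ => A) a x
    simp only [Equiv.prodComm_apply, Prod.swap_prod_mk, Fin.snocEquiv_apply,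
      Fin.prod_univ_castSucc, h0, h1, h2, Fin.snoc_castSucc, ENNReal.tsum_mul_left]
    simp [PMF.tsum_coe]

/-- The joint law of the first `m + 1` states of the first-order Markov chain with initial law `p`
and transition probabilities `κ`. -/
def chainLaw {A : Type*} (p : PMF A) (κ : A → PMF A) (m : ℕ) : PMF (Fin (m + 1) → A) :=
  ⟨fun x => p (x 0) * ∏ i : Fin m, κ (x i.castSucc) (x i.succ), by
    rw [← tsum_chain_eq_one p κ m]; exact ENNReal.summable.hasSum⟩

/-- The joint law of the source vectors `s₋₁ⁿ, s₀ⁿ, …, s_Lⁿ`: the entries of `s₋₁ⁿ` are i.i.d. with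
law `p`, and, given the past, the entries of the next vector are independent, the `k`-th one with
law `κ (s_{i-1,k})`.  The vector at time `i` is the coordinate with index `i + 1`. -/
def sourceLaw {S : Type*} (p : PMF S) (κ : S → PMF S) (n L : ℕ) :
    PMF (Fin (L + 2) → Fin n → S) :=
  chainLaw (prodLaw fun _ => p) (fun x => prodLaw fun k => κ (x k)) (L + 1)

/-! ### Streaming codes for the burst erasure channel -/

/-- A streaming code with block length `n`, `M` channel symbols and horizon `L`. -/
structure Code (S : Type*) (n M L : ℕ) where
  /-- The encoder at time `i` sees the source vectors at the times `-1, 0, …, i`. -/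
  enc : (i : Fin (L + 1)) → (Fin (i.val + 2) → Fin n → S) → Fin M
  /-- The decoder at time `i` sees the channel outputs at the times `0, …, i` (where `none` is the
  erasure symbol) and the source vector at time `-1`. -/
  dec : (i : Fin (L + 1)) → (Fin (i.val + 1) → Option (Fin M)) → (Fin n → S) → (Fin n → S)

namespace Code

variable {S : Type*} {n M L : ℕ}

/-- The channel input at time `i`. -/
def sent (c : Code S n M L) (x : Fin (L + 2) → Fin n → S) (i : Fin (L + 1)) : Fin M :=
  c.enc i fun k => x (Fin.castLE (by omega) k)

/-- The channel output at time `i`, when the burst erases exactly the times `j, …, j + b - 1`. -/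
def received (c : Code S n M L) (x : Fin (L + 2) → Fin n → S) (j b : ℕ) (i : Fin (L + 1)) :
    Option (Fin M) :=
  if j ≤ i.val ∧ i.val < j + b then none else some (c.sent x i)

/-- The reconstruction of the source vector at time `i`. -/
def recon (c : Code S n M L) (x : Fin (L + 2) → Fin n → S) (j b : ℕ) (i : Fin (L + 1)) :
    Fin n → S :=
  c.dec i (fun k => c.received x j b (Fin.castLE (by omega) k)) (x 0)

/-- The probability that the reconstruction of the source vector at time `i` is wrong. -/
def errorProb (p : PMF S) (κ : S → PMF S) (c : Code S n M L) (j b : ℕ) (i : Fin (L + 1)) : ℝ≥0∞ :=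
  (sourceLaw p κ n L).toOuterMeasure {x | c.recon x j b i ≠ x i.succ}

end Code

/-! ### The lossless rate-recovery function -/

/-- The rate `R` is feasible for horizon `L`: there are codes with channel symbols in
`{1, …, ⌊2^{nR}⌋}` such that, for every burst of length `b ≤ B`, starting at any time `j`, each
source vector outside the burst and the `W` time instants that follow it is recovered with an error
probability that vanishes as `n → ∞`. -/
def Feasible {S : Type*} (p : PMF S) (κ : S → PMF S) (B W L : ℕ) (R : ℝ) : Prop :=
  ∃ (c : (n : ℕ) → Code S n ⌊(2 : ℝ) ^ ((n : ℝ) * R)⌋₊ L) (ε : ℕ → ℝ≥0),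
    Tendsto ε atTop (𝓝 0) ∧
    ∀ (n j b : ℕ) (i : Fin (L + 1)), b ≤ B → (i.val < j ∨ j + b + W ≤ i.val) →
      (c n).errorProb p κ j b i ≤ ε n

/-- The finite-horizon rate-recovery function `R_L(B, W)`: the infimum of the feasible rates. -/
def finiteRateRecovery {S : Type*} (p : PMF S) (κ : S → PMF S) (B W L : ℕ) : EReal :=
  ⨅ (R : ℝ) (_ : Feasible p κ B W L R), (R : EReal)

/-- The rate-recovery function `R(B, W) = lim_{L → ∞} R_L(B, W)`. -/
def rateRecovery {S : Type*} (p : PMF S) (κ : S → PMF S) (B W : ℕ) : EReal :=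
  limUnder atTop fun L => finiteRateRecovery p κ B W L

/-! ### The two bounds -/

/-- `H(s₁ | s₀)`. -/
def entropyRate {S : Type*} (p : PMF S) (κ : S → PMF S) : ℝ :=
  condEntropy (chainLaw p κ 1) (fun x => x 1) (fun x => x 0)

/-- `I(s_a ; s_{a+d} | s₀)`. -/
def markovCMI {S : Type*} (p : PMF S) (κ : S → PMF S) (a d : ℕ) : ℝ :=
  condMutualInfo (chainLaw p κ (a + d)) (fun x => x ⟨a, by omega⟩) (fun x => x (Fin.last (a + d)))
    (fun x => x 0)

/-- `R⁺(B, W) = H(s₁ | s₀) + I(s_B ; s_{B+1} | s₀) / (W + 1)`. -/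
def upperBound {S : Type*} (p : PMF S) (κ : S → PMF S) (B W : ℕ) : ℝ :=
  entropyRate p κ + 1 / ((W : ℝ) + 1) * markovCMI p κ B 1

/-- `R⁻(B, W) = H(s₁ | s₀) + I(s_B ; s_{B+W+1} | s₀) / (W + 1)`. -/
def lowerBound {S : Type*} (p : PMF S) (κ : S → PMF S) (B W : ℕ) : ℝ :=
  entropyRate p κ + 1 / ((W : ℝ) + 1) * markovCMI p κ B (W + 1)

end

end BurstStreaming

/-! Write H_g = H(s_g | s_0) (`stepEntropy`). It is finite because H(s) is, and nondecreasing in g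
because conditioning reduces entropy. By the Markov property and stationarity I(s_a; s_{a+d} | s_0)
= H_{a+d} - H_d (`markovCMI_eq`), so the two bounds are H_1 + (H_{B+1} - H_1)/(W+1) and H_1 +
(H_{B+W+1} - H_{W+1})/(W+1). A code for horizon L+1 truncates to one for horizon L, so R_L is
nondecreasing and its limit exists as a supremum. It remains to prove the lower bound for the single
horizon B+W and the upper bound for every horizon.

Converse. Consider the W+1 messages sent at times B, …, B+W. If the burst erases the times 0, …,
B-1, these messages and s_{-1} determine s_{B+W}. If nothing is erased, the same messages and
s_{-1}, …, s_{B-1} determine s_B, …, s_{B+W}. So they carry H_{B+W+1} bits for the last state given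
s_{-1}, and then (W+1)H_1 - H_{W+1} bits for the states between given both ends; this total is W+1
times the lower bound. Instead of entropy inequalities, a one-shot estimate is used
(`chainLaw_guess_le`): the sequences that are decoded correctly and have a typical likelihood ratio
have probability at most (number of messages) · α, where α bounds that ratio. The weak law makes
typicality likely, and below the claimed rate the product tends to 0, a contradiction
(`lowerBound_le_of_feasible`).

Achievability. Each source vector is randomly binned, independently over time, and the decoder looks
for a typical sequence that starts at s_{-1} and matches all received bins. If it errs, take the
last unerased state before the decoded one at which its sequence is right: a run of r wrong unerased
states follows. Each wrong state costs a bin collision, of probability 1/M, while the number of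
typical runs is at most 2 to the power n times the sum of H_gap + δ along the run
(`tsum_collision_le`). All gaps are 1, except for one gap b+1 if the run crosses the burst; in that
case the recovery window forces r ≥ W+1. Hence the gap entropies sum to at most r times the upper
bound (`sum_stepEntropy_le`), and every larger rate is feasible. -/

namespace BurstStreaming

/-! ### Expectations and marginals -/

theorem tsum_pmf_map {A B : Type*} (q : PMF A) (T : A → B) (F : B → ℝ≥0∞) :
    ∑' y, q.map T y * F y = ∑' x, q x * F (T x) := by
  classical
  simp only [PMF.map_apply, ← ENNReal.tsum_mul_right]
  rw [ENNReal.tsum_comm]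
  refine tsum_congr fun x => ?_
  rw [tsum_eq_single (T x)]
  · simp
  · intro y hy
    simp [hy]

theorem tsum_pmf_bind {A B : Type*} (q : PMF A) (k : A → PMF B) (F : B → ℝ≥0∞) :
    ∑' y, q.bind k y * F y = ∑' x, q x * ∑' y, k x y * F y := by
  simp only [PMF.bind_apply, ← ENNReal.tsum_mul_right, ← ENNReal.tsum_mul_left]
  rw [ENNReal.tsum_comm]
  simp only [mul_assoc]

theorem tsum_pi_prod {A : Type*} :
    ∀ (n : ℕ) (g : Fin n → A → ℝ≥0∞), ∑' x : Fin n → A, ∏ k, g k (x k) = ∏ k, ∑' a, g k a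
  | 0, g => by simp
  | n + 1, g => by
    rw [← (Fin.consEquiv fun _ : Fin (n + 1) => A).tsum_eq]
    rw [ENNReal.tsum_prod']
    simp only [Fin.consEquiv_apply, Fin.prod_univ_succ, Fin.cons_zero, Fin.cons_succ,
      ENNReal.tsum_mul_left]
    rw [tsum_pi_prod n fun k => g k.succ]
    simp [ENNReal.tsum_mul_right]

theorem prodLaw_apply {A : Type*} {n : ℕ} (q : Fin n → PMF A) (x : Fin n → A) :
    prodLaw q x = ∏ k, q k (x k) := rfl

theorem chainLaw_apply {A : Type*} (p : PMF A) (κ : A → PMF A) (m : ℕ) (x : Fin (m + 1) → A) :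
    chainLaw p κ m x = p (x 0) * ∏ i : Fin m, κ (x i.castSucc) (x i.succ) := rfl

theorem prodLaw_bind {A : Type*} {n : ℕ} (q : Fin n → PMF A) (κ : A → PMF A) :
    (prodLaw q).bind (fun x => prodLaw fun k => κ (x k)) = prodLaw fun k => (q k).bind κ := by
  ext y
  simp only [PMF.bind_apply, prodLaw_apply, ← Finset.prod_mul_distrib]
  exact tsum_pi_prod n fun k a => q k a * κ a (y k)

/-- The law of the state after `g` steps of the chain started at `a`. -/
noncomputable def stepLaw {A : Type*} (κ : A → PMF A) : ℕ → A → PMF A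
  | 0, a => PMF.pure a
  | g + 1, a => (stepLaw κ g a).bind κ

theorem stepLaw_one {A : Type*} (κ : A → PMF A) (a : A) : stepLaw κ 1 a = κ a := by
  simp [stepLaw]

theorem stepLaw_add {A : Type*} (κ : A → PMF A) (g h : ℕ) (a : A) :
    stepLaw κ (g + h) a = (stepLaw κ g a).bind (stepLaw κ h) := by
  induction h with
  | zero =>
    change stepLaw κ g a = (stepLaw κ g a).bind PMF.pure
    simp
  | succ h ih =>
    change (stepLaw κ (g + h) a).bind κ = (stepLaw κ g a).bind fun b => (stepLaw κ h b).bind κ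
    rw [ih, PMF.bind_bind]

theorem prodLaw_pure {A : Type*} {n : ℕ} (x : Fin n → A) :
    prodLaw (fun k => PMF.pure (x k)) = PMF.pure x := by
  classical
  ext y
  simp only [prodLaw_apply, PMF.pure_apply, Finset.prod_ite_zero, Finset.prod_const_one]
  congr 1
  simp [funext_iff]

theorem stepLaw_prodLaw {A : Type*} {n : ℕ} (κ : A → PMF A) (g : ℕ) (x : Fin n → A) :
    stepLaw (fun x : Fin n → A => prodLaw fun k => κ (x k)) g x =
      prodLaw fun k => stepLaw κ g (x k) := by
  induction g with
  | zero => exact (prodLaw_pure x).symm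
  | succ g ih =>
    simp only [stepLaw]
    rw [ih, prodLaw_bind]

theorem bind_stepLaw {A : Type*} {p : PMF A} {κ : A → PMF A} (h : p.bind κ = p) (g : ℕ) :
    p.bind (stepLaw κ g) = p := by
  induction g with
  | zero => exact PMF.bind_pure p
  | succ g ih =>
    change p.bind (fun a => (stepLaw κ g a).bind κ) = p
    rw [← PMF.bind_bind, ih, h]

theorem chainLaw_snoc {A : Type*} (p : PMF A) (κ : A → PMF A) (m : ℕ) (x : Fin (m + 1) → A)
    (a : A) :
    chainLaw p κ (m + 1) (Fin.snoc x a : Fin (m + 2) → A) =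
      chainLaw p κ m x * κ (x (Fin.last m)) a := by
  have h0 : (Fin.snoc x a : Fin (m + 2) → A) 0 = x 0 :=
    Fin.snoc_castSucc (α := fun _ => A) a x 0
  have h1 : ∀ (i : Fin m), (Fin.snoc x a : Fin (m + 2) → A) i.castSucc.succ = x i.succ :=
    fun i => Fin.snoc_castSucc (α := fun _ => A) a x i.succ
  have h2 : (Fin.snoc x a : Fin (m + 2) → A) (Fin.last m).succ = a :=
    Fin.snoc_last (α := fun _ => A) a x
  simp only [chainLaw_apply, Fin.prod_univ_castSucc, h0, h1, h2, Fin.snoc_castSucc, mul_assoc]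

theorem tsum_chainLaw_succ {A : Type*} (p : PMF A) (κ : A → PMF A) (m : ℕ)
    (F : (Fin (m + 2) → A) → ℝ≥0∞) :
    ∑' x, chainLaw p κ (m + 1) x * F x =
      ∑' x, chainLaw p κ m x * ∑' a, κ (x (Fin.last m)) a * F (Fin.snoc x a : Fin (m + 2) → A) := by
  rw [← (Fin.snocEquiv fun _ : Fin (m + 2) => A).tsum_eq, ← (Equiv.prodComm _ _).tsum_eq,
      ENNReal.tsum_prod']
  refine tsum_congr fun x => ?_
  rw [← ENNReal.tsum_mul_left]
  refine tsum_congr fun a => ?_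
  have : (Fin.snocEquiv fun _ : Fin (m + 2) => A) ((Equiv.prodComm _ _) (x, a)) =
    (Fin.snoc x a : Fin (m + 2) → A) := rfl
  rw [this, chainLaw_snoc, mul_assoc]

theorem chainLaw_succ {A : Type*} (p : PMF A) (κ : A → PMF A) (m : ℕ) :
    chainLaw p κ (m + 1) = (chainLaw p κ m).bind fun x =>
      (κ (x (Fin.last m))).map fun a => (Fin.snoc x a : Fin (m + 2) → A) := by
  classical
  ext y
  have h := tsum_chainLaw_succ p κ m (fun x => if x = y then 1 else 0)
  have e : ∀ (q : PMF (Fin (m + 2) → A)), q y = ∑' x, q x * (if x = y then 1 else 0) := by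
    intro q
    simp
  rw [e, h, e, tsum_pmf_bind]
  refine tsum_congr fun x => ?_
  rw [tsum_pmf_map]

theorem chainLaw_map_init {A : Type*} (p : PMF A) (κ : A → PMF A) (m : ℕ) :
    (chainLaw p κ (m + 1)).map (fun x (i : Fin (m + 1)) => x i.castSucc) = chainLaw p κ m := by
  rw [chainLaw_succ, PMF.map_bind]
  simp only [PMF.map_comp]
  conv_rhs => rw [← PMF.bind_pure (chainLaw p κ m)]
  congr 1
  funext x
  have : ((fun (x : Fin (m + 2) → A) (i : Fin (m + 1)) => x i.castSucc) ∘
      fun a => (Fin.snoc x a : Fin (m + 2) → A)) = Function.const A x := by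
    funext a i
    simp
  rw [this, PMF.map_const]

theorem chainLaw_map_prefix {A : Type*} (p : PMF A) (κ : A → PMF A) {m u : ℕ} (h : u ≤ m) :
    (chainLaw p κ m).map (fun x (i : Fin (u + 1)) => x (Fin.castLE (by omega) i)) =
      chainLaw p κ u := by
  induction m, h using Nat.le_induction with
  | base => exact PMF.map_id _
  | succ m hm ih =>
    rw [← ih, ← chainLaw_map_init p κ m, PMF.map_comp]
    rfl

/-- The Markov property in the form from which the two- and three-state marginals used below are
read off. -/
theorem chainLaw_map_prefix_last {A : Type*} (p : PMF A) (κ : A → PMF A) (u g : ℕ) :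
    (chainLaw p κ (u + g)).map
        (fun x => ((fun i : Fin (u + 1) => x (Fin.castLE (by omega) i)), x (Fin.last (u + g)))) =
      (chainLaw p κ u).bind fun x => (stepLaw κ g (x (Fin.last u))).map fun b => (x, b) := by
  induction g with
  | zero =>
    simp only [stepLaw, PMF.pure_map]
    rfl
  | succ g ih =>
    simp only [stepLaw, PMF.map_bind]
    have h1 : ∀ x : Fin (u + 1) → A,
        ((stepLaw κ g (x (Fin.last u))).bind fun a => (κ a).map fun b => (x, b)) =
        ((stepLaw κ g (x (Fin.last u))).map fun b => (x, b)).bind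
          fun z => (κ z.2).map fun b => (z.1, b) := by
      intro x
      rw [PMF.bind_map]
      rfl
    simp only [h1]
    rw [← PMF.bind_bind, ← ih, PMF.bind_map]
    change (chainLaw p κ (u + g + 1)).map _ = _
    rw [chainLaw_succ, PMF.map_bind]
    congr 1
    funext x
    rw [PMF.map_comp]
    simp only [Function.comp_def]
    congr 1
    funext b
    refine Prod.ext ?_ ?_
    · funext i
      exact Fin.snoc_castSucc (α := fun _ => A) b x (Fin.castLE (by omega) i)
    · exact Fin.snoc_last (α := fun _ => A) b x

theorem chainLaw_zero_map {A : Type*} (p : PMF A) (κ : A → PMF A) :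
    (chainLaw p κ 0).map (fun x => x 0) = p := by
  classical
  ext a
  rw [PMF.map_apply, tsum_eq_single (fun _ => a)]
  · simp [chainLaw_apply]
  · intro x hx
    rw [if_neg]
    rintro rfl
    exact hx (funext fun i => congrArg x (Fin.ext (by omega)))

/-- The joint law of a state with law `p` and the state `g` steps later. -/
noncomputable def pairLaw {A : Type*} (p : PMF A) (κ : A → PMF A) (g : ℕ) : PMF (A × A) :=
  p.bind fun a => (stepLaw κ g a).map fun b => (a, b)

/-- The joint law of a state with law `p`, the state `a` steps later, and the state another `d`
steps later. -/
noncomputable def tripleLaw {A : Type*} (p : PMF A) (κ : A → PMF A) (a d : ℕ) : PMF (A × A × A) :=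
  p.bind fun x => (stepLaw κ a x).bind fun y => (stepLaw κ d y).map fun z => (x, y, z)

theorem pairLaw_apply {A : Type*} (p : PMF A) (κ : A → PMF A) (g : ℕ) (z : A × A) :
    pairLaw p κ g z = p z.1 * stepLaw κ g z.1 z.2 := by
  classical
  obtain ⟨a, b⟩ := z
  rw [pairLaw, PMF.bind_apply, tsum_eq_single a]
  · rw [PMF.map_apply, tsum_eq_single b]
    · simp
    · intro c hc
      simp [hc.symm]
  · intro c hc
    rw [PMF.map_apply]
    simp [hc.symm]

theorem tripleLaw_apply {A : Type*} (p : PMF A) (κ : A → PMF A) (a d : ℕ) (z : A × A × A) :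
    tripleLaw p κ a d z = p z.1 * (stepLaw κ a z.1 z.2.1 * stepLaw κ d z.2.1 z.2.2) := by
  classical
  obtain ⟨x, y, w⟩ := z
  rw [tripleLaw, PMF.bind_apply, tsum_eq_single x]
  · rw [PMF.bind_apply, tsum_eq_single y]
    · rw [PMF.map_apply, tsum_eq_single w]
      · simp
      · intro c hc
        simp [hc.symm]
    · intro c hc
      rw [PMF.map_apply]
      simp [hc.symm]
  · intro c hc
    simp [PMF.bind_apply, PMF.map_apply, hc.symm]

theorem chainLaw_map_zero_last {A : Type*} (p : PMF A) (κ : A → PMF A) (m : ℕ) :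
    (chainLaw p κ m).map (fun x => (x 0, x (Fin.last m))) = pairLaw p κ m := by
  obtain ⟨g, rfl⟩ : ∃ g, m = 0 + g := ⟨m, by omega⟩
  have h := congrArg (PMF.map fun z : (Fin 1 → A) × A => (z.1 0, z.2))
    (chainLaw_map_prefix_last p κ 0 g)
  rw [PMF.map_comp, PMF.map_bind] at h
  refine h.trans ?_
  conv_rhs => rw [← chainLaw_zero_map p κ, pairLaw, PMF.bind_map]
  simp only [PMF.map_comp, Nat.zero_add]
  rfl

theorem chainLaw_map_last {A : Type*} {p : PMF A} {κ : A → PMF A} (h : p.bind κ = p) (m : ℕ) :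
    (chainLaw p κ m).map (fun x => x (Fin.last m)) = p := by
  have h1 := congrArg (PMF.map Prod.snd) (chainLaw_map_zero_last p κ m)
  rw [PMF.map_comp] at h1
  refine h1.trans ?_
  rw [pairLaw, PMF.map_bind]
  conv_rhs => rw [← bind_stepLaw h m]
  congr 1
  funext a
  rw [PMF.map_comp]
  exact PMF.map_id _

theorem chainLaw_map_pair {A : Type*} {p : PMF A} {κ : A → PMF A} (h : p.bind κ = p) {m : ℕ}
    (u g : ℕ) (hug : u + g ≤ m) :
    (chainLaw p κ m).map (fun x => (x ⟨u, by omega⟩, x ⟨u + g, by omega⟩)) = pairLaw p κ g := by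
  have h1 : (chainLaw p κ (u + g)).map (fun x => (x ⟨u, by omega⟩, x ⟨u + g, by omega⟩)) =
      pairLaw p κ g := by
    have h2 := congrArg (PMF.map fun z : (Fin (u + 1) → A) × A => (z.1 (Fin.last u), z.2))
      (chainLaw_map_prefix_last p κ u g)
    rw [PMF.map_comp, PMF.map_bind] at h2
    refine h2.trans ?_
    conv_rhs => rw [← chainLaw_map_last h u, pairLaw, PMF.bind_map]
    simp only [PMF.map_comp]
    rfl
  rw [← h1, ← chainLaw_map_prefix p κ hug, PMF.map_comp]
  rfl

theorem chainLaw_map_triple {A : Type*} (p : PMF A) (κ : A → PMF A) (a d : ℕ) :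
    (chainLaw p κ (a + d)).map (fun x => (x 0, x ⟨a, by omega⟩, x (Fin.last (a + d)))) =
      tripleLaw p κ a d := by
  have h2 := congrArg (PMF.map fun z : (Fin (a + 1) → A) × A => (z.1 0, z.1 (Fin.last a), z.2))
      (chainLaw_map_prefix_last p κ a d)
  rw [PMF.map_comp, PMF.map_bind] at h2
  refine h2.trans ?_
  have h3 : tripleLaw p κ a d = (pairLaw p κ a).bind fun z =>
      (stepLaw κ d z.2).map fun w => (z.1, z.2, w) := by
    simp only [tripleLaw, pairLaw, PMF.bind_bind, PMF.bind_map]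
    rfl
  rw [h3, ← chainLaw_map_zero_last, PMF.bind_map]
  simp only [PMF.map_comp]
  rfl

/-- The columns of the source vectors are independent copies of the single-letter chain. -/
theorem sourceLaw_apply {S : Type*} (p : PMF S) (κ : S → PMF S) (n L : ℕ)
    (x : Fin (L + 2) → Fin n → S) :
    sourceLaw p κ n L x = prodLaw (fun _ : Fin n => chainLaw p κ (L + 1)) fun k t => x t k := by
  simp only [sourceLaw, chainLaw_apply, prodLaw_apply, Finset.prod_mul_distrib]
  rw [Finset.prod_comm]

/-- Turns events about source vectors into events about n i.i.d. samples of the whole chain, to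
which the weak law applies. -/
theorem sourceLaw_eq_map {S : Type*} (p : PMF S) (κ : S → PMF S) (n L : ℕ) :
    sourceLaw p κ n L =
      (prodLaw fun _ : Fin n => chainLaw p κ (L + 1)).map fun y t k => y k t := by
  classical
  ext x
  rw [sourceLaw_apply, PMF.map_apply, tsum_eq_single fun k t => x t k]
  · simp
  · intro y hy
    rw [if_neg]
    rintro rfl
    exact hy rfl

/-! ### Means of real functions -/

/-- The function `f` has the (absolutely convergent) mean `e` under `q`. -/
def HasMean {C : Type*} (q : PMF C) (f : C → ℝ) (e : ℝ) : Prop :=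
  HasSum (fun a => (q a).toReal * f a) e

theorem HasMean.add {C : Type*} {q : PMF C} {f g : C → ℝ} {a b : ℝ} (hf : HasMean q f a)
    (hg : HasMean q g b) : HasMean q (fun x => f x + g x) (a + b) := by
  simpa only [HasMean, mul_add] using HasSum.add hf hg

theorem HasMean.sub {C : Type*} {q : PMF C} {f g : C → ℝ} {a b : ℝ} (hf : HasMean q f a)
    (hg : HasMean q g b) : HasMean q (fun x => f x - g x) (a - b) := by
  simpa only [HasMean, mul_sub] using HasSum.sub hf hg

theorem hasMean_sum {C ι : Type*} {q : PMF C} (s : Finset ι) {f : ι → C → ℝ} {a : ι → ℝ}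
    (hf : ∀ i ∈ s, HasMean q (f i) (a i)) :
    HasMean q (fun x => ∑ i ∈ s, f i x) (∑ i ∈ s, a i) := by
  simp only [HasMean, Finset.mul_sum]
  exact hasSum_sum hf

theorem HasMean.tsum_ofReal {C : Type*} {q : PMF C} {f : C → ℝ} {e : ℝ} (hf : ∀ a, 0 ≤ f a)
    (h : HasMean q f e) : ∑' a, q a * ENNReal.ofReal (f a) = ENNReal.ofReal e := by
  rw [← HasSum.tsum_eq h, ENNReal.ofReal_tsum_of_nonneg
    (fun a => mul_nonneg ENNReal.toReal_nonneg (hf a)) h.summable]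
  refine tsum_congr fun a => ?_
  rw [ENNReal.ofReal_mul ENNReal.toReal_nonneg, ENNReal.ofReal_toReal (PMF.apply_ne_top q a)]

theorem hasMean_of_tsum_ofReal {C : Type*} {q : PMF C} {f : C → ℝ} {e : ℝ} (hf : ∀ a, 0 ≤ f a)
    (he : 0 ≤ e) (h : ∑' a, q a * ENNReal.ofReal (f a) = ENNReal.ofReal e) : HasMean q f e := by
  have h1 := ENNReal.hasSum_toReal (h ▸ ENNReal.ofReal_ne_top)
  rw [← ENNReal.tsum_toReal_eq (fun a => ENNReal.mul_ne_top (PMF.apply_ne_top q a)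
    ENNReal.ofReal_ne_top), h, ENNReal.toReal_ofReal he] at h1
  simpa only [HasMean, ENNReal.toReal_mul, ENNReal.toReal_ofReal (hf _)] using h1

/-- Non-negativity allows the sum to be regrouped along the fibres of `T` in [0, ∞], where no
summability is needed. -/
theorem HasMean.comp {C D : Type*} {q : PMF C} {T : C → D} {f : D → ℝ} {e : ℝ}
    (hf : ∀ a, 0 ≤ f a) (h : HasMean (q.map T) f e) : HasMean q (fun x => f (T x)) e := by
  refine hasMean_of_tsum_ofReal (fun a => hf _)
    (HasSum.nonneg (fun a => mul_nonneg ENNReal.toReal_nonneg (hf a)) h) ?_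
  rw [← h.tsum_ofReal hf, tsum_pmf_map]

theorem toReal_le_one {C : Type*} (q : PMF C) (a : C) : (q a).toReal ≤ 1 :=
  ENNReal.toReal_le_of_le_ofReal zero_le_one (by simpa using q.coe_le_one a)

theorem neg_logb_nonneg {C : Type*} (q : PMF C) (a : C) : 0 ≤ -Real.logb 2 (q a).toReal := by
  rw [neg_nonneg]
  exact Real.logb_nonpos one_lt_two ENNReal.toReal_nonneg (toReal_le_one q a)

/-- Gibbs' inequality before summation, from log t ≤ t - 1. Between two probability laws the
correction term sums to 0. -/
theorem mul_logb_sub_le {w v : ℝ} (hw : 0 ≤ w) (hv : 0 ≤ v) (h : w ≠ 0 → v ≠ 0) :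
    w * (-Real.logb 2 w) ≤ w * (-Real.logb 2 v) + (v - w) / Real.log 2 := by
  have h2 : 0 < Real.log 2 := Real.log_pos one_lt_two
  rcases eq_or_ne w 0 with rfl | hw0
  · simpa using div_nonneg hv h2.le
  have hw' : 0 < w := lt_of_le_of_ne hw hw0.symm
  have hv' : 0 < v := lt_of_le_of_ne hv (h hw0).symm
  have h3 : w * (Real.log v - Real.log w) ≤ v - w := by
    rw [← Real.log_div hv'.ne' hw0]
    calc w * Real.log (v / w) ≤ w * (v / w - 1) :=
          mul_le_mul_of_nonneg_left (Real.log_le_sub_one_of_pos (div_pos hv' hw')) hw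
      _ = v - w := by field_simp
  have h4 : w * (-Real.logb 2 v) + (v - w) / Real.log 2 - w * (-Real.logb 2 w) =
      ((v - w) - w * (Real.log v - Real.log w)) / Real.log 2 := by
    simp only [Real.logb]
    field_simp
    ring
  have h5 : 0 ≤ ((v - w) - w * (Real.log v - Real.log w)) / Real.log 2 :=
    div_nonneg (by linarith) h2.le
  linarith

/-! ### The entropies of the chain -/

section

variable {S : Type*} {p : PMF S} {κ : S → PMF S}

theorem pairLaw_map_fst (p : PMF S) (κ : S → PMF S) (g : ℕ) : (pairLaw p κ g).map Prod.fst = p := by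
  rw [pairLaw, PMF.map_bind]
  simp only [PMF.map_comp]
  conv_rhs => rw [← PMF.bind_pure p]
  congr 1
  funext a
  exact PMF.map_const _ _

theorem pairLaw_map_snd (hstat : p.bind κ = p) (g : ℕ) : (pairLaw p κ g).map Prod.snd = p := by
  rw [pairLaw, PMF.map_bind]
  simp only [PMF.map_comp]
  conv_rhs => rw [← bind_stepLaw hstat g]
  congr 1
  funext a
  exact PMF.map_id _

theorem tripleLaw_map_right (hstat : p.bind κ = p) (a d : ℕ) :
    (tripleLaw p κ a d).map Prod.snd = pairLaw p κ d := by
  rw [tripleLaw, pairLaw]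
  conv_rhs => rw [← bind_stepLaw hstat a]
  simp only [PMF.map_bind, PMF.map_comp, PMF.bind_bind]
  rfl

theorem tripleLaw_map_outer (p : PMF S) (κ : S → PMF S) (a d : ℕ) :
    (tripleLaw p κ a d).map (fun z => (z.1, z.2.2)) = pairLaw p κ (a + d) := by
  rw [tripleLaw, pairLaw]
  simp only [PMF.map_bind, PMF.map_comp, stepLaw_add]
  rfl

theorem tripleLaw_map_left (p : PMF S) (κ : S → PMF S) (a d : ℕ) :
    (tripleLaw p κ a d).map (fun z => (z.1, z.2.1)) = pairLaw p κ a := by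
  rw [tripleLaw, pairLaw]
  simp only [PMF.map_bind, PMF.map_comp]
  congr 1
  funext x
  conv_rhs => rw [← PMF.bind_pure_comp]
  congr 1
  funext y
  change (stepLaw κ d y).map (Function.const S (x, y)) = _
  rw [PMF.map_const]
  rfl

/-- The conditional entropy `H(s_g | s_0)` of the chain. -/
noncomputable def stepEntropy (p : PMF S) (κ : S → PMF S) (g : ℕ) : ℝ :=
  ∑' z : S × S, (pairLaw p κ g z).toReal * (-Real.logb 2 (stepLaw κ g z.1 z.2).toReal)

theorem map_apply_ne_zero {C D : Type*} (q : PMF C) (T : C → D) {x : C} (h : q x ≠ 0) :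
    q.map T (T x) ≠ 0 := by
  rw [← PMF.mem_support_iff] at h ⊢
  rw [PMF.support_map]
  exact ⟨x, h, rfl⟩

/-- Convergence holds because H(s_g | s_0) ≤ H(s_g) = H(s): the terms are compared with those of the
marginal entropy through Gibbs' inequality. This is where the finiteness of H(s) enters. -/
theorem hasMean_stepEntropy (hstat : p.bind κ = p) (hfin : FiniteEntropy p) (g : ℕ) :
    HasMean (pairLaw p κ g) (fun z => -Real.logb 2 (stepLaw κ g z.1 z.2).toReal)
      (stepEntropy p κ g) := by
  refine Summable.hasSum ?_
  have h1 : HasMean p (fun b => -Real.logb 2 (p b).toReal)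
      (∑' b, (p b).toReal * (-Real.logb 2 (p b).toReal)) := by
    refine Summable.hasSum ?_
    simpa only [FiniteEntropy, one_div, Real.logb_inv] using hfin
  rw [← pairLaw_map_snd hstat g] at h1
  have h2 := (h1.comp (T := Prod.snd)
    (fun b => by rw [pairLaw_map_snd hstat g]; exact neg_logb_nonneg p b)).summable
  rw [pairLaw_map_snd hstat g] at h2
  have hp : Summable fun a => (p a).toReal := ENNReal.summable_toReal p.tsum_coe_ne_top
  have h3 : Summable fun z : S × S => (p z.1).toReal * (p z.2).toReal / Real.log 2 :=
    (hp.mul_of_nonneg hp (fun _ => ENNReal.toReal_nonneg)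
      (fun _ => ENNReal.toReal_nonneg)).div_const _
  refine Summable.of_nonneg_of_le
    (fun z => mul_nonneg ENNReal.toReal_nonneg (neg_logb_nonneg _ _)) ?_ (h2.add h3)
  intro z
  rcases eq_or_ne (pairLaw p κ g z) 0 with h0 | h0
  · rw [h0]
    simp only [ENNReal.toReal_zero, zero_mul, zero_add]
    exact div_nonneg (mul_nonneg ENNReal.toReal_nonneg ENNReal.toReal_nonneg)
      (Real.log_pos one_lt_two).le
  have h4 : p z.2 ≠ 0 := by
    have := map_apply_ne_zero _ Prod.snd h0
    rwa [pairLaw_map_snd hstat g] at this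
  have h5 := mul_logb_sub_le (w := (stepLaw κ g z.1 z.2).toReal) (v := (p z.2).toReal)
    ENNReal.toReal_nonneg ENNReal.toReal_nonneg
    (fun _ => ENNReal.toReal_ne_zero.2 ⟨h4, p.apply_ne_top _⟩)
  rw [pairLaw_apply, ENNReal.toReal_mul]
  have h6 := mul_le_mul_of_nonneg_left h5 (ENNReal.toReal_nonneg (a := p z.1))
  have h7 : 0 ≤ (p z.1).toReal * ((stepLaw κ g z.1 z.2).toReal / Real.log 2) :=
    mul_nonneg ENNReal.toReal_nonneg
      (div_nonneg ENNReal.toReal_nonneg (Real.log_pos one_lt_two).le)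
  calc _ = (p z.1).toReal * ((stepLaw κ g z.1 z.2).toReal *
          -Real.logb 2 (stepLaw κ g z.1 z.2).toReal) := by ring
    _ ≤ _ := h6
    _ = _ - (p z.1).toReal * ((stepLaw κ g z.1 z.2).toReal / Real.log 2) := by ring
    _ ≤ _ := sub_le_self _ h7

theorem HasMean.of_map {C D : Type*} {q : PMF C} {r : PMF D} {T : C → D} {f : D → ℝ} {e : ℝ}
    (h : HasMean r f e) (hT : q.map T = r) (hf : ∀ a, 0 ≤ f a) : HasMean q (fun x => f (T x)) e :=
  HasMean.comp hf (hT ▸ h)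

theorem neg_logb_stepLaw_nonneg (κ : S → PMF S) (g : ℕ) (z : S × S) :
    0 ≤ -Real.logb 2 (stepLaw κ g z.1 z.2).toReal :=
  neg_logb_nonneg (stepLaw κ g z.1) z.2

theorem hasMean_tripleLaw_right (hstat : p.bind κ = p) (hfin : FiniteEntropy p) (a d : ℕ) :
    HasMean (tripleLaw p κ a d) (fun z => -Real.logb 2 (stepLaw κ d z.2.1 z.2.2).toReal)
      (stepEntropy p κ d) := by
  exact (hasMean_stepEntropy hstat hfin d).of_map (tripleLaw_map_right hstat a d)
    (neg_logb_stepLaw_nonneg κ d)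

theorem hasMean_tripleLaw_left (hstat : p.bind κ = p) (hfin : FiniteEntropy p) (a d : ℕ) :
    HasMean (tripleLaw p κ a d) (fun z => -Real.logb 2 (stepLaw κ a z.1 z.2.1).toReal)
      (stepEntropy p κ a) := by
  have h := (hasMean_stepEntropy hstat hfin a).of_map (tripleLaw_map_left p κ a d)
    (neg_logb_stepLaw_nonneg κ a)
  dsimp only at h
  exact h

theorem hasMean_tripleLaw_outer (hstat : p.bind κ = p) (hfin : FiniteEntropy p) (a d : ℕ) :
    HasMean (tripleLaw p κ a d) (fun z => -Real.logb 2 (stepLaw κ (a + d) z.1 z.2.2).toReal)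
      (stepEntropy p κ (a + d)) := by
  have h := (hasMean_stepEntropy hstat hfin (a + d)).of_map (tripleLaw_map_outer p κ a d)
    (neg_logb_stepLaw_nonneg κ (a + d))
  dsimp only at h
  exact h

theorem hasSum_toReal {C : Type*} (q : PMF C) : HasSum (fun a => (q a).toReal) 1 := by
  have := ENNReal.hasSum_toReal q.tsum_coe_ne_top
  rwa [← ENNReal.tsum_toReal_eq q.apply_ne_top, q.tsum_coe, ENNReal.toReal_one] at this

/-- Conditioning reduces entropy: H(s_{a+d} | s_a) = H(s_{a+d} | s_0, s_a) ≤ H(s_{a+d} | s_0). -/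
theorem stepEntropy_le_add (hstat : p.bind κ = p) (hfin : FiniteEntropy p) (a d : ℕ) :
    stepEntropy p κ d ≤ stepEntropy p κ (a + d) := by
  have hr := hasMean_tripleLaw_right hstat hfin a d
  have ho := hasMean_tripleLaw_outer hstat hfin a d
  have ht := hasSum_toReal (tripleLaw p κ a d)
  -- The comparison law makes s_a and s_{a+d} independent given s_0. It has total mass 1 like the
  -- true law, so the Gibbs correction sums to 0.
  have hq : HasSum (fun z : S × S × S =>
      (p z.1 * (stepLaw κ a z.1 z.2.1 * stepLaw κ (a + d) z.1 z.2.2)).toReal) 1 := by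
    have h1 : ∑' z : S × S × S, p z.1 * (stepLaw κ a z.1 z.2.1 * stepLaw κ (a + d) z.1 z.2.2) =
        1 := by
      simp only [ENNReal.tsum_prod', ENNReal.tsum_mul_left, PMF.tsum_coe, mul_one]
    have h2 := ENNReal.hasSum_toReal (h1.trans_ne ENNReal.one_ne_top)
    rwa [← ENNReal.tsum_toReal_eq (fun z => ENNReal.mul_ne_top (PMF.apply_ne_top _ _)
      (ENNReal.mul_ne_top (PMF.apply_ne_top _ _) (PMF.apply_ne_top _ _))), h1,
      ENNReal.toReal_one] at h2
  have hsum := HasSum.add ho ((hq.sub ht).div_const (Real.log 2))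
  rw [sub_self, zero_div, add_zero] at hsum
  refine hasSum_le ?_ hr hsum
  intro z
  rcases eq_or_ne (tripleLaw p κ a d z) 0 with h0 | h0
  · rw [h0]
    simp only [ENNReal.toReal_zero, zero_mul, zero_add, sub_zero]
    exact div_nonneg ENNReal.toReal_nonneg (Real.log_pos one_lt_two).le
  have h4 : stepLaw κ (a + d) z.1 z.2.2 ≠ 0 := by
    have := map_apply_ne_zero _ (fun z : S × S × S => (z.1, z.2.2)) h0
    rw [tripleLaw_map_outer, pairLaw_apply] at this
    exact right_ne_zero_of_mul this
  have h5 := mul_logb_sub_le (w := (stepLaw κ d z.2.1 z.2.2).toReal)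
    (v := (stepLaw κ (a + d) z.1 z.2.2).toReal) ENNReal.toReal_nonneg ENNReal.toReal_nonneg
    (fun _ => ENNReal.toReal_ne_zero.2 ⟨h4, PMF.apply_ne_top _ _⟩)
  have h6 := mul_le_mul_of_nonneg_left h5
    (ENNReal.toReal_nonneg (a := p z.1 * stepLaw κ a z.1 z.2.1))
  rw [tripleLaw_apply]
  simp only [ENNReal.toReal_mul] at h6 ⊢
  refine le_trans (le_of_eq ?_) (h6.trans (le_of_eq ?_))
  · ring
  · ring

theorem stepEntropy_mono (hstat : p.bind κ = p) (hfin : FiniteEntropy p) :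
    Monotone (stepEntropy p κ) := by
  intro d e h
  obtain ⟨a, rfl⟩ := Nat.exists_eq_add_of_le' h
  exact stepEntropy_le_add hstat hfin a d

theorem map_apply_of_injective {C D : Type*} (q : PMF C) {T : C → D} (hT : T.Injective) (x : C) :
    q.map T (T x) = q x := by
  classical
  rw [PMF.map_apply, tsum_eq_single x]
  · simp
  · intro y hy
    rw [if_neg fun h => hy (hT h.symm)]

theorem condEntropy_eq_stepEntropy {Ω : Type*} (μ : PMF Ω) (X Z : Ω → S) (g : ℕ)
    (h : μ.map (fun ω => (Z ω, X ω)) = pairLaw p κ g) :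
    condEntropy μ X Z = stepEntropy p κ g := by
  have hZ : μ.map Z = p := by
    rw [← pairLaw_map_fst p κ g, ← h, PMF.map_comp]
    rfl
  have hXZ : μ.map (fun ω => (X ω, Z ω)) = (pairLaw p κ g).map Prod.swap := by
    rw [← h, PMF.map_comp]
    rfl
  rw [condEntropy, stepEntropy, ← (Equiv.prodComm S S).tsum_eq]
  refine tsum_congr fun z => ?_
  have h1 : (Equiv.prodComm S S) z = z.swap := rfl
  rw [h1, hZ, hXZ, map_apply_of_injective _ Prod.swap_injective, Prod.snd_swap]
  rcases eq_or_ne (pairLaw p κ g z) 0 with h0 | h0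
  · simp [h0]
  rw [pairLaw_apply] at h0 ⊢
  have hp := ENNReal.toReal_ne_zero.2 ⟨left_ne_zero_of_mul h0, PMF.apply_ne_top _ _⟩
  rw [ENNReal.toReal_mul, div_mul_cancel_left₀ hp, Real.logb_inv]

theorem entropyRate_eq (hstat : p.bind κ = p) : entropyRate p κ = stepEntropy p κ 1 :=
  condEntropy_eq_stepEntropy _ _ _ 1 (chainLaw_map_pair hstat 0 1 le_rfl)

theorem condEntropy_triple {Ω : Type*} (μ : PMF Ω) (X Y Z : Ω → S) (a d : ℕ)
    (hstat : p.bind κ = p) (hfin : FiniteEntropy p)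
    (h : μ.map (fun ω => (Z ω, X ω, Y ω)) = tripleLaw p κ a d) :
    condEntropy μ X (fun ω => (Y ω, Z ω)) =
      stepEntropy p κ a + stepEntropy p κ d - stepEntropy p κ (a + d) := by
  let e : S × S × S ≃ S × S × S :=
    { toFun := fun z => (z.2.1, z.2.2, z.1)
      invFun := fun z => (z.2.2, z.1, z.2.1)
      left_inv := fun _ => rfl
      right_inv := fun _ => rfl }
  have hYZ : μ.map (fun ω => (Y ω, Z ω)) = (pairLaw p κ (a + d)).map Prod.swap := by
    rw [← tripleLaw_map_outer, ← h, PMF.map_comp, PMF.map_comp]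
    rfl
  have hXYZ : μ.map (fun ω => (X ω, Y ω, Z ω)) = (tripleLaw p κ a d).map e := by
    rw [← h, PMF.map_comp]
    rfl
  have hs := ((hasMean_tripleLaw_left hstat hfin a d).add
    (hasMean_tripleLaw_right hstat hfin a d)).sub (hasMean_tripleLaw_outer hstat hfin a d)
  rw [condEntropy, ← e.tsum_eq, ← HasSum.tsum_eq hs]
  refine tsum_congr fun z => ?_
  have h1 : (e z).2 = (z.1, z.2.2).swap := rfl
  rw [hXYZ, hYZ, map_apply_of_injective _ e.injective, h1,
    map_apply_of_injective _ Prod.swap_injective]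
  rcases eq_or_ne (tripleLaw p κ a d z) 0 with h0 | h0
  · simp [h0]
  have h4 : stepLaw κ (a + d) z.1 z.2.2 ≠ 0 := by
    have := map_apply_ne_zero _ (fun z : S × S × S => (z.1, z.2.2)) h0
    rw [tripleLaw_map_outer, pairLaw_apply] at this
    exact right_ne_zero_of_mul this
  rw [tripleLaw_apply] at h0 ⊢
  rw [pairLaw_apply]
  have hp := ENNReal.toReal_ne_zero.2 ⟨left_ne_zero_of_mul h0, PMF.apply_ne_top _ _⟩
  have ha := ENNReal.toReal_ne_zero.2
    ⟨left_ne_zero_of_mul (right_ne_zero_of_mul h0), PMF.apply_ne_top _ _⟩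
  have hd := ENNReal.toReal_ne_zero.2
    ⟨right_ne_zero_of_mul (right_ne_zero_of_mul h0), PMF.apply_ne_top _ _⟩
  have h4' := ENNReal.toReal_ne_zero.2 ⟨h4, PMF.apply_ne_top _ _⟩
  simp only [ENNReal.toReal_mul]
  rw [mul_div_mul_left _ _ hp, Real.logb_div h4' (mul_ne_zero ha hd), Real.logb_mul ha hd]
  ring

/-- The chain rule gives H(s_a | s_{a+d}, s_0) = H_a + H_d - H_{a+d}, and subtracting this from H_a
cancels H_a. -/
theorem markovCMI_eq (hstat : p.bind κ = p) (hfin : FiniteEntropy p) (a d : ℕ) :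
    markovCMI p κ a d = stepEntropy p κ (a + d) - stepEntropy p κ d := by
  have h1 := chainLaw_map_pair hstat (m := a + d) 0 a (by omega)
  simp only [Nat.zero_add] at h1
  change (chainLaw p κ (a + d)).map (fun x => (x 0, x ⟨a, by omega⟩)) = pairLaw p κ a at h1
  rw [markovCMI, condMutualInfo, condEntropy_eq_stepEntropy _ _ _ a h1,
    condEntropy_triple _ _ _ _ a d hstat hfin (chainLaw_map_triple p κ a d)]
  ring

theorem upperBound_eq (hstat : p.bind κ = p) (hfin : FiniteEntropy p) (B W : ℕ) :
    upperBound p κ B W = stepEntropy p κ 1 +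
      1 / ((W : ℝ) + 1) * (stepEntropy p κ (B + 1) - stepEntropy p κ 1) := by
  rw [upperBound, entropyRate_eq hstat, markovCMI_eq hstat hfin]

theorem lowerBound_eq (hstat : p.bind κ = p) (hfin : FiniteEntropy p) (B W : ℕ) :
    lowerBound p κ B W = stepEntropy p κ 1 +
      1 / ((W : ℝ) + 1) * (stepEntropy p κ (B + (W + 1)) - stepEntropy p κ (W + 1)) := by
  rw [lowerBound, entropyRate_eq hstat, markovCMI_eq hstat hfin]

end

/-! ### The weak law of large numbers -/

section

open MeasureTheory ProbabilityTheory

theorem integrable_of_hasMean {C : Type*} [Countable C] [MeasurableSpace C]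
    [DiscreteMeasurableSpace C] {q : PMF C} {f : C → ℝ} {e : ℝ} (h : HasMean q f e) :
    Integrable f q.toMeasure ∧ ∫ x, f x ∂q.toMeasure = e := by
  have hint : Integrable f q.toMeasure := by
    refine ⟨(measurable_of_countable f).aestronglyMeasurable, ?_⟩
    rw [hasFiniteIntegral_iff_norm, lintegral_countable']
    have h1 := (Summable.norm (f := fun a => (q a).toReal * f a) h.summable).tsum_ofReal_ne_top
    refine lt_of_le_of_ne le_top ?_
    convert h1 using 3 with a
    rw [PMF.toMeasure_apply_singleton _ _ (measurableSet_singleton a), norm_mul, mul_comm,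
      ENNReal.ofReal_mul (norm_nonneg _), Real.norm_of_nonneg ENNReal.toReal_nonneg,
      ENNReal.ofReal_toReal (q.apply_ne_top a)]
  refine ⟨hint, ?_⟩
  rw [PMF.integral_eq_tsum q f hint]
  exact HasSum.tsum_eq h

theorem prodLaw_toMeasure {C : Type*} [Countable C] [MeasurableSpace C]
    [DiscreteMeasurableSpace C] (q : PMF C) (n : ℕ) :
    (prodLaw fun _ : Fin n => q).toMeasure = Measure.pi fun _ => q.toMeasure := by
  refine Measure.ext_of_singleton fun x => ?_
  rw [PMF.toMeasure_apply_singleton _ _ (measurableSet_singleton x), Measure.pi_singleton]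
  rw [prodLaw_apply]
  exact Finset.prod_congr rfl fun k _ =>
    (PMF.toMeasure_apply_singleton q (x k) (measurableSet_singleton _)).symm

/-- Obtained from the strong law on the infinite product, since almost sure convergence implies
convergence in measure; only a first moment is available. -/
theorem weak_law {C : Type*} [Countable C] {q : PMF C} {f : C → ℝ} {e δ : ℝ} (h : HasMean q f e)
    (hδ : 0 < δ) :
    Tendsto (fun n : ℕ => (prodLaw fun _ : Fin n => q).toOuterMeasure
      {x | δ ≤ |(∑ k, f (x k)) / n - e|}) atTop (𝓝 0) := by
  let _ : MeasurableSpace C := ⊤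
  have hd : DiscreteMeasurableSpace C := inferInstance
  obtain ⟨hint, hmean⟩ := integrable_of_hasMean h
  have hpres := measurePreserving_eval_infinitePi (fun _ : ℕ => q.toMeasure)
  have hX : ∀ i : ℕ, Measurable fun ω : ℕ → C => f (ω i) := fun i =>
    (measurable_of_countable f).comp (measurable_pi_apply i)
  have hlaw := strong_law_ae_real (μ := Measure.infinitePi fun _ : ℕ => q.toMeasure)
    (fun i ω => f (ω i)) ((hpres 0).integrable_comp_of_integrable hint)
    (fun i j hij => (iIndepFun_infinitePi (X := fun (_ : ℕ) (c : C) => f c)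
      (fun _ => measurable_of_countable f)).indepFun hij)
    (fun i => ⟨(hX i).aemeasurable, (hX 0).aemeasurable, by
      have h1 : ∀ i : ℕ, (Measure.infinitePi fun _ : ℕ => q.toMeasure).map (fun ω => f (ω i)) =
          q.toMeasure.map f := by
        intro i
        conv_rhs => rw [← (hpres i).map_eq]
        rw [Measure.map_map (measurable_of_countable f)
          (measurable_pi_apply i)]
        rfl
      rw [h1, h1]⟩)
  have hmean' : ∫ ω, f (ω 0) ∂(Measure.infinitePi fun _ : ℕ => q.toMeasure) = e := by
    conv_rhs => rw [← hmean, ← (hpres 0).map_eq]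
    rw [integral_map (measurable_pi_apply 0).aemeasurable
        (measurable_of_countable f).aestronglyMeasurable]
  rw [hmean'] at hlaw
  have hm := tendstoInMeasure_of_tendsto_ae
    (fun n => ((Finset.measurable_sum (Finset.range n) fun i _ => hX i).div_const
      (n : ℝ)).aestronglyMeasurable) hlaw
  rw [tendstoInMeasure_iff_dist] at hm
  refine (hm δ hδ).congr fun n => ?_
  -- The event depends on the first n coordinates only, so its probability can be computed under the
  -- finite product.
  have hmap : (Measure.infinitePi fun _ : ℕ => q.toMeasure).map (fun ω (k : Fin n) => ω k) =
      (prodLaw fun _ : Fin n => q).toMeasure := by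
    rw [prodLaw_toMeasure, ← Measure.infinitePi_eq_pi]
    exact Measure.map_infinitePi_infinitePi_of_inj (P := fun _ : ℕ => q.toMeasure)
      Fin.val_injective
  have hmeas : Measurable fun (ω : ℕ → C) (k : Fin n) => ω k :=
    measurable_pi_lambda _ fun k => measurable_pi_apply _
  rw [← PMF.toMeasure_apply_eq_toOuterMeasure, ← hmap, Measure.map_apply hmeas .of_discrete]
  congr 1
  ext ω
  simp only [Set.mem_ofPred_eq, Set.mem_preimage, Real.dist_eq]
  rw [Finset.sum_range]

end

/-! ### The asymptotic equipartition property -/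

theorem prod_two_rpow {n : ℕ} (c : Fin n → ℝ) : ∏ k, (2 : ℝ) ^ c k = 2 ^ ∑ k, c k :=
  (Real.rpow_sum_of_pos two_pos c Finset.univ).symm

/-- The asymptotic equipartition property, for a weight `w` in the place of the density. -/
theorem prod_weight_concentrates {C : Type*} [Countable C] {q : PMF C} {w : C → ℝ} {e δ : ℝ}
    (hw : ∀ a, q a ≠ 0 → 0 < w a) (h : HasMean q (fun a => -Real.logb 2 (w a)) e) (hδ : 0 < δ) :
    Tendsto (fun n : ℕ => (prodLaw fun _ : Fin n => q).toOuterMeasure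
      {x | ¬ (2 ^ (-(n * (e + δ))) ≤ ∏ k, w (x k) ∧ ∏ k, w (x k) ≤ 2 ^ (-(n * (e - δ))))})
      atTop (𝓝 0) := by
  refine tendsto_of_tendsto_of_tendsto_of_le_of_le' tendsto_const_nhds (weak_law h hδ)
    (Eventually.of_forall fun _ => zero_le) ?_
  filter_upwards [eventually_gt_atTop 0] with n hn
  have hn' : (0 : ℝ) < n := Nat.cast_pos.2 hn
  -- The inclusion is needed only on the support, where the weights are positive.
  refine PMF.toOuterMeasure_mono _ ?_
  rintro x ⟨hx, hxs⟩
  rw [Set.mem_ofPred_eq] at hx ⊢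
  by_contra! hlt
  refine hx ?_
  have hq : ∀ k, 0 < w (x k) := fun k => hw _ fun h0 =>
    (PMF.mem_support_iff _ _).1 hxs (Finset.prod_eq_zero (Finset.mem_univ k) h0)
  have hprod : ∏ k, w (x k) = 2 ^ (-∑ k, -Real.logb 2 (w (x k))) := by
    rw [Finset.sum_neg_distrib, neg_neg, ← prod_two_rpow]
    exact Finset.prod_congr rfl fun k _ =>
      (Real.rpow_logb two_pos (by norm_num) (hq k)).symm
  obtain ⟨h1, h2⟩ := abs_lt.1 hlt
  have h3 : (∑ k, -Real.logb 2 (w (x k))) / n < e + δ := by linarith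
  have h4 : e - δ < (∑ k, -Real.logb 2 (w (x k))) / n := by linarith
  rw [div_lt_iff₀ hn'] at h3
  rw [lt_div_iff₀ hn'] at h4
  rw [hprod]
  constructor <;> refine Real.rpow_le_rpow_of_exponent_le one_le_two ?_ <;> linarith

/-! ### The columns of the source -/

section

variable {S : Type*} {p : PMF S} {κ : S → PMF S}

theorem stepLaw_ne_zero_of_chainLaw (hstat : p.bind κ = p) {m : ℕ} (u g : ℕ) (h : u + g ≤ m)
    {y : Fin (m + 1) → S} (hy : chainLaw p κ m y ≠ 0) :
    stepLaw κ g (y ⟨u, by omega⟩) (y ⟨u + g, by omega⟩) ≠ 0 := by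
  have h1 := map_apply_ne_zero _
    (fun x : Fin (m + 1) → S => (x ⟨u, by omega⟩, x ⟨u + g, by omega⟩)) hy
  rw [chainLaw_map_pair hstat u g h, pairLaw_apply] at h1
  exact right_ne_zero_of_mul h1

theorem hasMean_chainLaw (hstat : p.bind κ = p) (hfin : FiniteEntropy p) {m : ℕ} (u g : ℕ)
    (h : u + g ≤ m) :
    HasMean (chainLaw p κ m)
      (fun y => -Real.logb 2 (stepLaw κ g (y ⟨u, by omega⟩) (y ⟨u + g, by omega⟩)).toReal)
      (stepEntropy p κ g) := by
  have h := (hasMean_stepEntropy hstat hfin g).of_map (chainLaw_map_pair hstat u g h)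
    (neg_logb_stepLaw_nonneg κ g)
  dsimp only at h
  exact h

theorem sourceLaw_ne_zero {n L : ℕ} {x : Fin (L + 2) → Fin n → S} (h : sourceLaw p κ n L x ≠ 0)
    (k : Fin n) : chainLaw p κ (L + 1) (fun t => x t k) ≠ 0 := by
  rw [sourceLaw_apply, prodLaw_apply] at h
  exact Finset.prod_ne_zero_iff.1 h k (Finset.mem_univ k)

theorem sourceLaw_weight_concentrates [Countable S] {L : ℕ} {w : (Fin (L + 2) → S) → ℝ} {e δ : ℝ}
    (hw : ∀ a, chainLaw p κ (L + 1) a ≠ 0 → 0 < w a)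
    (h : HasMean (chainLaw p κ (L + 1)) (fun a => -Real.logb 2 (w a)) e) (hδ : 0 < δ) :
    Tendsto (fun n : ℕ => (sourceLaw p κ n L).toOuterMeasure
      {x | ¬ (2 ^ (-(n * (e + δ))) ≤ ∏ k, w (fun t => x t k) ∧
        ∏ k, w (fun t => x t k) ≤ 2 ^ (-(n * (e - δ))))}) atTop (𝓝 0) := by
  refine (prod_weight_concentrates hw h hδ).congr fun n => ?_
  rw [sourceLaw_eq_map, PMF.toOuterMeasure_map_apply]
  rfl

end

/-! ### The converse -/

theorem chainLaw_eq_mul {A : Type*} (p : PMF A) (κ : A → PMF A) (a d : ℕ)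
    (x : Fin (a + d + 1) → A) :
    chainLaw p κ (a + d) x = chainLaw p κ a (fun i => x (Fin.castLE (by omega) i)) *
      ∏ i : Fin d, κ (x ⟨a + i, by omega⟩) (x ⟨a + i + 1, by omega⟩) := by
  simp only [chainLaw_apply, Fin.prod_univ_add, mul_assoc]
  rfl

/-- A set on which the whole chain is a function of its first `B + 1` states and a message, and the
last state is a function of the first one and the message, has a small probability. -/
theorem chainLaw_guess_le {A T : Type*} [Fintype T] (p : PMF A) (κ : A → PMF A) (B d : ℕ)
    (φ : A → T → A) (ψ : (Fin (B + 1) → A) → T → (Fin (B + d + 1) → A)) (α : ℝ≥0∞)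
    (hsupp : ∀ x, chainLaw p κ (B + d) x ≠ 0 → stepLaw κ (B + d) (x 0) (x (Fin.last _)) ≠ 0) :
    (chainLaw p κ (B + d)).toOuterMeasure
      {x | (∃ t, x = ψ (fun i => x (Fin.castLE (by omega) i)) t ∧ x (Fin.last _) = φ (x 0) t) ∧
        (chainLaw p κ (B + d) x ≠ 0 →
        chainLaw p κ (B + d) x * stepLaw κ (B + d) (x 0) (x (Fin.last _)) ≤
          α * (chainLaw p κ B (fun i => x (Fin.castLE (by omega) i)) *
            stepLaw κ d (x ⟨B, by omega⟩) (x (Fin.last _))))} ≤ Fintype.card T * α := by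
  classical
  -- The density condition solved for the probability of x, with u the first B+1 states and z the
  -- last one.
  let H : (Fin (B + 1) → A) → A → ℝ≥0∞ := fun u z =>
    α * (chainLaw p κ B u * (stepLaw κ d (u (Fin.last B)) z / stepLaw κ (B + d) (u 0) z))
  have h1 : ∀ t : T, ∑' u, H u (φ (u 0) t) ≤ α := by
    intro t
    have h2 := tsum_pmf_map (chainLaw p κ B) (fun x => (x 0, x (Fin.last B))) fun z =>
      stepLaw κ d z.2 (φ z.1 t) / stepLaw κ (B + d) z.1 (φ z.1 t)
    rw [ENNReal.tsum_mul_left, ← h2, chainLaw_map_zero_last]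
    conv_rhs => rw [← mul_one α, ← p.tsum_coe]
    gcongr
    simp only [pairLaw_apply, ENNReal.tsum_prod', mul_assoc, ENNReal.tsum_mul_left]
    gcongr with a
    -- By Chapman–Kolmogorov the numerators sum to the denominator. This works because the guess `φ
    -- a t` of the last state does not depend on the state b at index B.
    have h3 : ∑' b, stepLaw κ B a b * (stepLaw κ d b (φ a t) / stepLaw κ (B + d) a (φ a t)) =
        stepLaw κ (B + d) a (φ a t) / stepLaw κ (B + d) a (φ a t) := by
      conv_rhs => rw [div_eq_mul_inv]
      conv_rhs => arg 1; rw [stepLaw_add, PMF.bind_apply]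
      simp only [div_eq_mul_inv, ← mul_assoc, ENNReal.tsum_mul_right]
    rw [h3]
    exact (mul_le_mul_right ENNReal.div_self_le_one _).trans (mul_one _).le
  rw [PMF.toOuterMeasure_apply]
  calc _ ≤ ∑' x, ∑ t : T, ∑' u, if x = ψ u t then H u (φ (u 0) t) else 0 := by
        refine ENNReal.tsum_le_tsum fun x => ?_
        refine Set.indicator_apply_le' (fun hx => ?_) (fun _ => bot_le)
        obtain ⟨⟨t, ht, hlast⟩, hle⟩ := hx
        refine le_trans ?_ (Finset.single_le_sum (f := fun t => ∑' u, if x = ψ u t then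
          H u (φ (u 0) t) else 0) (fun _ _ => zero_le) (Finset.mem_univ t))
        refine le_trans ?_ (ENNReal.le_tsum fun i => x (Fin.castLE (by omega) i))
        rw [if_pos ht]
        rcases eq_or_ne (chainLaw p κ (B + d) x) 0 with h0 | h0
        · rw [h0]; exact zero_le
        have h4 := hsupp x h0
        have h5 : φ (x (Fin.castLE (by omega) (0 : Fin (B + 1)))) t = x (Fin.last _) := hlast.symm
        change _ ≤ α * (_ * (stepLaw κ d _ (φ _ t) / stepLaw κ (B + d) _ (φ _ t)))
        rw [h5, ← mul_div_assoc, ← mul_div_assoc]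
        exact (ENNReal.le_div_iff_mul_le (Or.inl h4) (Or.inl (PMF.apply_ne_top _ _))).2 (hle h0)
    _ = ∑ t : T, ∑' u, H u (φ (u 0) t) := by
        rw [Summable.tsum_finsetSum fun _ _ => ENNReal.summable]
        refine Finset.sum_congr rfl fun t _ => ?_
        rw [ENNReal.tsum_comm]
        exact tsum_congr fun u => tsum_ite_eq _ _
    _ ≤ ∑ _t : T, α := Finset.sum_le_sum fun t _ => h1 t
    _ = _ := by simp

section

variable {S : Type*} {p : PMF S} {κ : S → PMF S}

/-- The likelihood ratio of the converse: its logarithm is the information that the messages at the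
times `B, …, B + W` carry. -/
noncomputable def messageWeight (κ : S → PMF S) (B W : ℕ) (y : Fin (B + W + 2) → S) : ℝ :=
  (stepLaw κ (B + (W + 1)) (y 0) (y (Fin.last _))).toReal *
    (∏ i : Fin (W + 1), (κ (y ⟨B + i, by omega⟩) (y ⟨B + i + 1, by omega⟩)).toReal) /
    (stepLaw κ (W + 1) (y ⟨B, by omega⟩) (y (Fin.last _))).toReal

theorem toReal_pos_of_ne_zero {C : Type*} (q : PMF C) {a : C} (h : q a ≠ 0) : 0 < (q a).toReal :=
  ENNReal.toReal_pos h (q.apply_ne_top a)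

theorem stepLaw_outer_ne_zero (hstat : p.bind κ = p) {B W : ℕ} {y : Fin (B + W + 2) → S}
    (hy : chainLaw p κ (B + W + 1) y ≠ 0) :
    stepLaw κ (B + (W + 1)) (y 0) (y (Fin.last _)) ≠ 0 := by
  have h := stepLaw_ne_zero_of_chainLaw hstat 0 (B + (W + 1)) (by omega) hy
  simp only [Nat.zero_add] at h
  exact h

theorem stepLaw_inner_ne_zero (hstat : p.bind κ = p) {B W : ℕ} {y : Fin (B + W + 2) → S}
    (hy : chainLaw p κ (B + W + 1) y ≠ 0) :
    stepLaw κ (W + 1) (y ⟨B, by omega⟩) (y (Fin.last _)) ≠ 0 :=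
  stepLaw_ne_zero_of_chainLaw hstat B (W + 1) (by omega) hy

theorem transition_ne_zero (hstat : p.bind κ = p) {B W : ℕ} {y : Fin (B + W + 2) → S}
    (hy : chainLaw p κ (B + W + 1) y ≠ 0) (i : Fin (W + 1)) :
    κ (y ⟨B + i, by omega⟩) (y ⟨B + i + 1, by omega⟩) ≠ 0 := by
  rw [← stepLaw_one κ]
  exact stepLaw_ne_zero_of_chainLaw hstat (B + i) 1 (by omega) hy

theorem messageWeight_pos (hstat : p.bind κ = p) {B W : ℕ} {y : Fin (B + W + 2) → S}
    (hy : chainLaw p κ (B + W + 1) y ≠ 0) : 0 < messageWeight κ B W y :=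
  div_pos (mul_pos (toReal_pos_of_ne_zero _ (stepLaw_outer_ne_zero hstat hy))
    (Finset.prod_pos fun i _ => toReal_pos_of_ne_zero _ (transition_ne_zero hstat hy i)))
    (toReal_pos_of_ne_zero _ (stepLaw_inner_ne_zero hstat hy))

theorem HasMean.congr {C : Type*} {q : PMF C} {f g : C → ℝ} {e : ℝ} (h : HasMean q f e)
    (hfg : ∀ a, q a ≠ 0 → g a = f a) : HasMean q g e := by
  have : (fun a => (q a).toReal * g a) = fun a => (q a).toReal * f a := by
    funext a
    rcases eq_or_ne (q a) 0 with h0 | h0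
    · simp [h0]
    · rw [hfg a h0]
  rw [HasMean, this]
  exact h

/-- The factors contribute H_{B+W+1}, then H_1 for each of the W+1 transitions, and -H_{W+1} for the
denominator. -/
theorem hasMean_messageWeight (hstat : p.bind κ = p) (hfin : FiniteEntropy p) (B W : ℕ) :
    HasMean (chainLaw p κ (B + W + 1)) (fun y => -Real.logb 2 (messageWeight κ B W y))
      (((W : ℝ) + 1) * lowerBound p κ B W) := by
  have h1 : HasMean (chainLaw p κ (B + W + 1))
      (fun y => -Real.logb 2 (stepLaw κ (B + (W + 1)) (y 0) (y (Fin.last _))).toReal)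
      (stepEntropy p κ (B + (W + 1))) := by
    have h := hasMean_chainLaw hstat hfin (m := B + W + 1) 0 (B + (W + 1)) (by omega)
    simp only [Nat.zero_add] at h
    exact h
  have h2 : HasMean (chainLaw p κ (B + W + 1))
      (fun y => -Real.logb 2 (stepLaw κ (W + 1) (y ⟨B, by omega⟩) (y (Fin.last _))).toReal)
      (stepEntropy p κ (W + 1)) :=
    hasMean_chainLaw hstat hfin (m := B + W + 1) B (W + 1) (by omega)
  have h3 : ∀ i : Fin (W + 1), HasMean (chainLaw p κ (B + W + 1))
      (fun y => -Real.logb 2 (κ (y ⟨B + i, by omega⟩) (y ⟨B + i + 1, by omega⟩)).toReal)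
      (stepEntropy p κ 1) := by
    intro i
    have h := hasMean_chainLaw hstat hfin (m := B + W + 1) (B + i) 1 (by omega)
    simp only [stepLaw_one] at h
    exact h
  have h4 := (h1.add (hasMean_sum Finset.univ fun i _ => h3 i)).sub h2
  have h5 : stepEntropy p κ (B + (W + 1)) + ∑ _i : Fin (W + 1), stepEntropy p κ 1 -
      stepEntropy p κ (W + 1) = ((W : ℝ) + 1) * lowerBound p κ B W := by
    rw [lowerBound_eq hstat hfin, Finset.sum_const, Finset.card_univ, Fintype.card_fin,
      nsmul_eq_mul, Nat.cast_add, Nat.cast_one]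
    field_simp
    ring
  rw [← h5]
  refine h4.congr fun y hy => ?_
  have ha := (toReal_pos_of_ne_zero _ (stepLaw_outer_ne_zero hstat hy)).ne'
  have hb := (toReal_pos_of_ne_zero _ (stepLaw_inner_ne_zero hstat hy)).ne'
  have hc : ∀ i ∈ (Finset.univ : Finset (Fin (W + 1))), _ := fun i _ =>
    (toReal_pos_of_ne_zero _ (transition_ne_zero hstat hy i)).ne'
  rw [messageWeight, Real.logb_div (mul_ne_zero ha (Finset.prod_ne_zero_iff.2 hc)) hb,
    Real.logb_mul ha (Finset.prod_ne_zero_iff.2 hc), Real.logb_prod _ _ hc,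
    Finset.sum_neg_distrib]
  ring

/-- For a typical source sequence, the density is bounded as in `chainLaw_guess_le`. -/
theorem sourceLaw_mul_le (hstat : p.bind κ = p) {B W n : ℕ} {x : Fin (B + W + 2) → Fin n → S}
    (hx : sourceLaw p κ n (B + W) x ≠ 0) {r : ℝ}
    (hr : ∏ k, messageWeight κ B W (fun t => x t k) ≤ r) :
    sourceLaw p κ n (B + W) x *
        stepLaw (fun x : Fin n → S => prodLaw fun k => κ (x k)) (B + (W + 1)) (x 0)
          (x (Fin.last _)) ≤
      ENNReal.ofReal r * (chainLaw (prodLaw fun _ : Fin n => p)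
          (fun x => prodLaw fun k => κ (x k)) B (fun i => x (Fin.castLE (by omega) i)) *
        stepLaw (fun x : Fin n → S => prodLaw fun k => κ (x k)) (W + 1) (x ⟨B, by omega⟩)
          (x (Fin.last _))) := by
  have hcol := sourceLaw_ne_zero hx
  have h1 := chainLaw_eq_mul (prodLaw fun _ : Fin n => p) (fun x => prodLaw fun k => κ (x k)) B
    (W + 1) x
  change sourceLaw p κ n (B + W) x = _ at h1
  rw [h1, stepLaw_prodLaw, stepLaw_prodLaw, mul_assoc, mul_left_comm (ENNReal.ofReal r)]
  gcongr _ * ?_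
  refine le_trans (le_of_eq ?_) (mul_le_mul_left (ENNReal.ofReal_le_ofReal hr) _)
  rw [ENNReal.ofReal_prod_of_nonneg fun k _ => (messageWeight_pos hstat (hcol k)).le]
  simp only [prodLaw_apply]
  rw [Finset.prod_comm, ← Finset.prod_mul_distrib, ← Finset.prod_mul_distrib]
  refine Finset.prod_congr rfl fun k _ => ?_
  have hb := toReal_pos_of_ne_zero _ (stepLaw_inner_ne_zero hstat (hcol k))
  rw [messageWeight, ENNReal.ofReal_div_of_pos hb, ENNReal.ofReal_toReal (PMF.apply_ne_top _ _),
    ENNReal.div_mul_cancel (stepLaw_inner_ne_zero hstat (hcol k)) (PMF.apply_ne_top _ _),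
    ENNReal.ofReal_mul ENNReal.toReal_nonneg, ENNReal.ofReal_toReal (PMF.apply_ne_top _ _),
    ENNReal.ofReal_prod_of_nonneg fun _ _ => ENNReal.toReal_nonneg, mul_comm]
  congr 1
  exact Finset.prod_congr rfl fun i _ => (ENNReal.ofReal_toReal (PMF.apply_ne_top _ _)).symm

/-- The error probabilities of any code for the horizon `B + W` are bounded below. -/
theorem one_le_errorProb_add (hstat : p.bind κ = p) {B W n M : ℕ} (c : Code S n M (B + W)) (r : ℝ) :
    1 ≤ c.errorProb p κ 0 B (Fin.last _) +
      ∑ i : Fin (W + 1), c.errorProb p κ (B + W + 1) 0 ⟨B + i, by omega⟩ +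
      (sourceLaw p κ n (B + W)).toOuterMeasure
        {x | ¬ ∏ k, messageWeight κ B W (fun t => x t k) ≤ r} +
      (M : ℝ≥0∞) ^ (W + 1) * ENNReal.ofReal r := by
  -- The last decoder when the times before B are erased: it sees only the initial vector and the
  -- messages t.
  let φ : (Fin n → S) → (Fin (W + 1) → Fin M) → (Fin n → S) := fun a t =>
    c.dec (Fin.last _) (fun k => if h : k.val < B then none else
      some (t ⟨k.val - B, by have := k.isLt; simp only [Fin.val_last] at this; omega⟩)) a
  -- Decoding without erasures: the messages before time B are recomputed from the known vectors u,
  -- the later ones are t. The vector with index i is decoded at time i - 1.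
  let ψ : (Fin (B + 1) → Fin n → S) → (Fin (W + 1) → Fin M) →
      (Fin (B + (W + 1) + 1) → Fin n → S) := fun u t i =>
    if h : i.val < B + 1 then u ⟨i, h⟩ else
      c.dec ⟨i.val - 1, by omega⟩ (fun k => if h : k.val < B then
        some (c.enc ⟨k.val, by omega⟩ fun j => u (Fin.castLE (by simp only; omega) j)) else
        some (t ⟨k.val - B, by have := k.isLt; simp only at this; omega⟩)) (u 0)
  have hguess := chainLaw_guess_le (prodLaw fun _ : Fin n => p)
    (fun x => prodLaw fun k => κ (x k)) B (W + 1) φ ψ (ENNReal.ofReal r) fun x hx => by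
      rw [stepLaw_prodLaw, prodLaw_apply]
      exact Finset.prod_ne_zero_iff.2 fun k _ =>
        stepLaw_outer_ne_zero hstat (sourceLaw_ne_zero (L := B + W) hx k)
  rw [Fintype.card_fun, Fintype.card_fin, Fintype.card_fin, Nat.cast_pow] at hguess
  have huniv : (1 : ℝ≥0∞) = (sourceLaw p κ n (B + W)).toOuterMeasure Set.univ :=
    ((PMF.toOuterMeasure_apply_eq_one_iff _ _).2 (Set.subset_univ _)).symm
  rw [huniv]
  let E : Fin (B + W + 1) → ℕ → ℕ → Set (Fin (B + W + 2) → Fin n → S) := fun i j b =>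
    {x | c.recon x j b i ≠ x i.succ}
  -- The burst that starts at B+W+1 with length 0 lies beyond the horizon: it encodes an
  -- erasure-free channel on which every time must be decoded.
  refine le_trans (MeasureTheory.measure_mono (t := ((E (Fin.last _) 0 B ∪
    ⋃ i : Fin (W + 1), E ⟨B + i, by omega⟩ (B + W + 1) 0) ∪
    {x | ¬ ∏ k, messageWeight κ B W (fun t => x t k) ≤ r}) ∪ _) ?_)
    ((MeasureTheory.measure_union_le _ _).trans (add_le_add ((MeasureTheory.measure_union_le _ _).trans
      (add_le_add ((MeasureTheory.measure_union_le _ _).trans (add_le_add le_rfl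
        (MeasureTheory.measure_iUnion_fintype_le _ _))) le_rfl)) hguess))
  intro x _
  by_cases h1 : x ∈ E (Fin.last _) 0 B
  · exact Or.inl (Or.inl (Or.inl h1))
  by_cases h2 : x ∈ ⋃ i : Fin (W + 1), E ⟨B + i, by omega⟩ (B + W + 1) 0
  · exact Or.inl (Or.inl (Or.inr h2))
  by_cases h3 : ∏ k, messageWeight κ B W (fun t => x t k) ≤ r
  swap
  · exact Or.inl (Or.inr h3)
  refine Or.inr ⟨⟨fun k => c.sent x ⟨B + k, by omega⟩, ?_, ?_⟩, fun h0 =>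
    sourceLaw_mul_le hstat h0 h3⟩
  · funext i
    simp only [ψ]
    split_ifs with hi
    · rfl
    · obtain ⟨i, hilt⟩ := i
      obtain ⟨t, rfl⟩ : ∃ t, i = B + t + 1 := ⟨i - (B + 1), by simp only at hi; omega⟩
      have ht : c.recon x (B + W + 1) 0 ⟨B + t, by omega⟩ = x ⟨B + t + 1, by omega⟩ := by
        by_contra hne
        exact h2 (Set.mem_iUnion.2 ⟨⟨t, by omega⟩, hne⟩)
      refine ht.symm.trans ?_
      change c.dec ⟨B + t, _⟩ _ (x 0) = c.dec ⟨B + t, _⟩ _ (x 0)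
      congr 1
      funext k
      have hk : k.val < B + t + 1 := k.isLt
      rw [Code.received, if_neg (by simp only [Fin.val_castLE]; omega)]
      split_ifs with hkB
      · rfl
      · congr 2
        exact Fin.ext (by simp only [Fin.val_castLE]; omega)
  · have ht : c.recon x 0 B (Fin.last _) = x (Fin.last _) := by
      by_contra hne
      exact h1 hne
    refine ht.symm.trans ?_
    change c.dec _ _ (x 0) = c.dec _ _ (x 0)
    congr 1
    funext k
    have hk : k.val < B + W + 1 := k.isLt
    rw [Code.received]
    split_ifs with h4 h5 h5
    · rfl
    · simp only [Fin.val_castLE] at h4; omega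
    · simp only [Fin.val_castLE] at h4; omega
    · congr 2
      exact Fin.ext (by simp only [Fin.val_castLE]; omega)

theorem lowerBound_le_of_feasible [Countable S] (hstat : p.bind κ = p) (hfin : FiniteEntropy p)
    {B W : ℕ} {R : ℝ} (h : Feasible p κ B W (B + W) R) : lowerBound p κ B W ≤ R := by
  by_contra! hlt
  obtain ⟨c, ε, hε, hc⟩ := h
  have hW : (0 : ℝ) < (W : ℝ) + 1 := by positivity
  set e := ((W : ℝ) + 1) * lowerBound p κ B W with he
  -- With half of the gap spent on typicality, the guessing term is at most 2^(n(W+1)R) ·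
  -- 2^(-n(e-δ)) = 2^(-nδ).
  set δ := (e - (W + 1) * R) / 2 with hδdef
  have hδ : 0 < δ := by
    have := mul_lt_mul_of_pos_left hlt hW
    rw [hδdef]
    linarith
  have hconc := sourceLaw_weight_concentrates (L := B + W) (w := messageWeight κ B W)
    (fun a ha => messageWeight_pos hstat ha) (hasMean_messageWeight hstat hfin B W) hδ
  have hε' : Tendsto (fun n => (ε n : ℝ≥0∞)) atTop (𝓝 0) := by
    exact ENNReal.tendsto_coe.2 hε
  have hpow : Tendsto (fun n : ℕ => ENNReal.ofReal (2 ^ (-(n * δ)))) atTop (𝓝 0) := by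
    have h1 : Tendsto (fun n : ℕ => ((2 : ℝ) ^ (-δ)) ^ n) atTop (𝓝 0) :=
      tendsto_pow_atTop_nhds_zero_of_lt_one (by positivity)
        (Real.rpow_lt_one_of_one_lt_of_neg one_lt_two (by linarith))
    have h2 := ENNReal.tendsto_ofReal h1
    rw [ENNReal.ofReal_zero] at h2
    refine h2.congr fun n => ?_
    rw [← Real.rpow_natCast, ← Real.rpow_mul two_pos.le]
    ring_nf
  have hlim := ((hε'.add (tendsto_finsetSum (Finset.univ : Finset (Fin (W + 1)))
    fun _ _ => hε')).add hconc).add hpow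
  simp only [add_zero, Finset.sum_const_zero] at hlim
  suffices (1 : ℝ≥0∞) ≤ 0 by simp at this
  refine ge_of_tendsto' hlim fun n => ?_
  refine (one_le_errorProb_add hstat (c n) (2 ^ (-(n * (e - δ))))).trans ?_
  refine add_le_add (add_le_add (add_le_add ?_ (Finset.sum_le_sum fun i _ => ?_)) ?_) ?_
  · exact hc n 0 B _ le_rfl (Or.inr (by simp))
  · exact hc n _ 0 _ (Nat.zero_le _) (Or.inl (by have := i.isLt; simp only; omega))
  · refine MeasureTheory.measure_mono fun x hx hx2 => hx hx2.2
  · have h1 : ((⌊(2 : ℝ) ^ ((n : ℝ) * R)⌋₊ : ℕ) : ℝ≥0∞) ≤ ENNReal.ofReal (2 ^ ((n : ℝ) * R)) := by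
      rw [← ENNReal.ofReal_natCast]
      exact ENNReal.ofReal_le_ofReal (Nat.floor_le (by positivity))
    refine (mul_le_mul_left (pow_le_pow_left₀ bot_le h1 _) _).trans (le_of_eq ?_)
    rw [← ENNReal.ofReal_pow (by positivity), ← ENNReal.ofReal_mul (by positivity),
      ← Real.rpow_natCast, ← Real.rpow_mul two_pos.le, ← Real.rpow_add two_pos]
    congr 2
    push_cast
    rw [hδdef]
    ring

end

/-! ### Random binning -/

section

/-- The kernels vary with the index because a run that crosses the burst makes one step of a
different length. -/
theorem tsum_kernel_chain_eq_one {A : Type*} (p : PMF A) :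
    ∀ (r : ℕ) (k : Fin r → A → PMF A),
      ∑' z : Fin (r + 1) → A, p (z 0) * ∏ i : Fin r, k i (z i.castSucc) (z i.succ) = 1
  | 0, k => by
    rw [← (Equiv.funUnique (Fin 1) A).symm.tsum_eq]
    simp [PMF.tsum_coe]
  | r + 1, k => by
    rw [← (Fin.snocEquiv fun _ : Fin (r + 2) => A).tsum_eq, ← (Equiv.prodComm _ _).tsum_eq,
      ENNReal.tsum_prod', ← tsum_kernel_chain_eq_one p r fun i => k i.castSucc]
    refine tsum_congr fun x => ?_
    have h0 : ∀ a : A, (Fin.snoc x a : Fin (r + 2) → A) 0 = x 0 := fun a =>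
      Fin.snoc_castSucc (α := fun _ => A) a x 0
    have h1 : ∀ (a : A) (i : Fin r),
        (Fin.snoc x a : Fin (r + 2) → A) i.castSucc.succ = x i.succ := fun a i =>
      Fin.snoc_castSucc (α := fun _ => A) a x i.succ
    have h2 : ∀ a : A, (Fin.snoc x a : Fin (r + 2) → A) (Fin.last r).succ = a := fun a =>
      Fin.snoc_last (α := fun _ => A) a x
    simp only [Equiv.prodComm_apply, Prod.swap_prod_mk, Fin.snocEquiv_apply,
      Fin.prod_univ_castSucc, h0, h1, h2, Fin.snoc_castSucc, ENNReal.tsum_mul_left]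
    simp [PMF.tsum_coe]

/-- Independence of the binnings used at distinct times. -/
theorem tsum_prodLaw_injective {Θ : Type*} (U : PMF Θ) {N r : ℕ} {t : Fin r → Fin N}
    (ht : t.Injective) (G : Fin r → Θ → ℝ≥0∞) :
    ∑' h : Fin N → Θ, prodLaw (fun _ => U) h * ∏ k, G k (h (t k)) =
      ∏ k, ∑' a, U a * G k a := by
  classical
  let G' : Fin N → Θ → ℝ≥0∞ := fun τ a => if hτ : ∃ k, t k = τ then G hτ.choose a else 1
  have hG : ∀ k, G' (t k) = G k := by
    intro k
    funext a
    have hk : ∃ k', t k' = t k := ⟨k, rfl⟩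
    simp only [G', dif_pos hk]
    rw [ht hk.choose_spec]
  have hG' : ∀ τ, τ ∉ Set.range t → G' τ = fun _ => 1 := by
    intro τ hτ
    funext a
    exact dif_neg hτ
  have h1 : ∀ h : Fin N → Θ, ∏ k, G k (h (t k)) = ∏ τ, G' τ (h τ) := fun h =>
    Fintype.prod_of_injective t ht _ _ (fun τ hτ => by rw [hG' τ hτ]) fun k => by rw [hG]
  simp only [h1, prodLaw_apply, ← Finset.prod_mul_distrib]
  rw [tsum_pi_prod N fun τ a => U a * G' τ a]
  refine (Fintype.prod_of_injective t ht _ _ (fun τ hτ => ?_) fun k => by rw [hG]).symm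
  rw [hG' τ hτ]
  simp [PMF.tsum_coe]

theorem tsum_uniform_collision {X : Type*} [Fintype X] [DecidableEq X] {M : ℕ} [NeZero M]
    {a b : X} (hab : a ≠ b) :
    ∑' f, PMF.uniformOfFintype (X → Fin M) f * (if f a = f b then 1 else 0) = (M : ℝ≥0∞)⁻¹ := by
  have hba : b ≠ a := hab.symm
  simp only [PMF.uniformOfFintype_apply, ENNReal.tsum_mul_left]
  have h1 : ∑' f : X → Fin M, (if f a = f b then (1 : ℝ≥0∞) else 0) =
      Fintype.card ({j // j ≠ a} → Fin M) := by
    rw [← (Equiv.funSplitAt a (Fin M)).symm.tsum_eq, ← (Equiv.prodComm _ _).tsum_eq,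
      ENNReal.tsum_prod']
    have : ∀ (g : {j // j ≠ a} → Fin M) (c : Fin M),
        (if (Equiv.funSplitAt a (Fin M)).symm ((Equiv.prodComm _ _) (g, c)) a =
          (Equiv.funSplitAt a (Fin M)).symm ((Equiv.prodComm _ _) (g, c)) b
          then (1 : ℝ≥0∞) else 0) = if c = g ⟨b, hba⟩ then 1 else 0 := by
      intro g c
      simp [Equiv.funSplitAt, Equiv.piSplitAt, hba]
    simp only [this, tsum_ite_eq]
    simp
  have h2 : (Fintype.card (X → Fin M) : ℝ≥0∞) = M * Fintype.card ({j // j ≠ a} → Fin M) := by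
    rw [Fintype.card_congr (Equiv.funSplitAt a (Fin M)), Fintype.card_prod, Fintype.card_fin,
      Nat.cast_mul]
  have h3 : (Fintype.card ({j // j ≠ a} → Fin M) : ℝ≥0∞) ≠ 0 :=
    Nat.cast_ne_zero.2 Fintype.card_ne_zero
  rw [h1, h2, ENNReal.mul_inv (Or.inl (Nat.cast_ne_zero.2 (NeZero.ne M)))
    (Or.inl (ENNReal.natCast_ne_top M)), mul_assoc,
    ENNReal.inv_mul_cancel h3 (ENNReal.natCast_ne_top _), mul_one]

open Classical in
/-- The law of independent uniformly random binnings of the finite set `F` into `M` bins. -/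
noncomputable def binningLaw {A : Type*} (F : Finset A) (M : ℕ) [NeZero M] (N : ℕ) :
    PMF (Fin N → F → Fin M) :=
  prodLaw fun _ => PMF.uniformOfFintype (F → Fin M)

open Classical in
/-- The bin of `a` in a binning of the finite set `F`, extended by `0`. -/
noncomputable def binOf {A : Type*} {F : Finset A} {M : ℕ} [NeZero M] (f : F → Fin M) (a : A) :
    Fin M :=
  if ha : a ∈ F then f ⟨a, ha⟩ else 0

open Classical in
-- Union bound over wrong runs: r independent collisions have probability at most M^(-r), and since
-- path probabilities sum to 1, at most ∏ θ_i⁻¹ paths from a₀ have every transition probability at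
-- least θ_i.
theorem tsum_collision_le {A : Type*} (F : Finset A) (M : ℕ) [NeZero M] {N r : ℕ}
    {t : Fin r → Fin N} (ht : t.Injective) (a₀ : A) (X : Fin r → A) (k : Fin r → A → PMF A)
    (θ : Fin r → ℝ≥0∞) (hθ : ∀ i, θ i ≠ 0) (hθ' : ∀ i, θ i ≠ ⊤) :
    ∑' h, binningLaw F M N h * (if ∃ z : Fin (r + 1) → A, z 0 = a₀ ∧ ∀ i : Fin r,
        (z i.succ ∈ F ∧ X i ∈ F ∧ z i.succ ≠ X i ∧
          binOf (h (t i)) (z i.succ) = binOf (h (t i)) (X i)) ∧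
        θ i ≤ k i (z i.castSucc) (z i.succ) then 1 else 0) ≤
      ∏ i, ((M : ℝ≥0∞)⁻¹ * (θ i)⁻¹) := by
  let C : Fin r → A → (F → Fin M) → ℝ≥0∞ := fun i a f =>
    if a ∈ F ∧ X i ∈ F ∧ a ≠ X i ∧ binOf f a = binOf f (X i) then 1 else 0
  have hC : ∀ i a, ∑' f, PMF.uniformOfFintype (F → Fin M) f * C i a f ≤ (M : ℝ≥0∞)⁻¹ := by
    intro i a
    by_cases h : a ∈ F ∧ X i ∈ F ∧ a ≠ X i
    · obtain ⟨h1, h2, h3⟩ := h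
      have h4 : (⟨a, h1⟩ : F) ≠ ⟨X i, h2⟩ := fun h => h3 (congrArg Subtype.val h)
      rw [← tsum_uniform_collision h4]
      refine le_of_eq (tsum_congr fun f => ?_)
      simp only [C, binOf, h1, h2, h3, dif_pos, true_and, ne_eq, not_false_eq_true]
    · have : ∀ f, C i a f = 0 := fun f => if_neg fun hh => h ⟨hh.1, hh.2.1, hh.2.2.1⟩
      simp [this]
  -- The indicator of θ_i ≤ k_i is replaced by the larger ratio k_i / θ_i, so that the sum over
  -- paths becomes a total probability.
  calc _ ≤ ∑' h, binningLaw F M N h * ∑' z : Fin (r + 1) → A, PMF.pure a₀ (z 0) *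
        (∏ i, ((θ i)⁻¹ * k i (z i.castSucc) (z i.succ))) * ∏ i, C i (z i.succ) (h (t i)) := by
        gcongr with h
        split_ifs with hz
        swap
        · exact bot_le
        obtain ⟨z, hz0, hz⟩ := hz
        refine le_trans ?_ (ENNReal.le_tsum z)
        have h1 : ∀ i, C i (z i.succ) (h (t i)) = 1 := fun i => if_pos (hz i).1
        simp only [h1, hz0, PMF.pure_apply, if_true, Finset.prod_const_one, mul_one, one_mul]
        refine Finset.one_le_prod' fun i _ => ?_
        rw [← ENNReal.inv_mul_cancel (hθ i) (hθ' i)]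
        gcongr
        exact (hz i).2
    _ = ∑' z : Fin (r + 1) → A, PMF.pure a₀ (z 0) *
        (∏ i, ((θ i)⁻¹ * k i (z i.castSucc) (z i.succ))) *
          ∏ i, ∑' f, PMF.uniformOfFintype (F → Fin M) f * C i (z i.succ) f := by
        simp only [← ENNReal.tsum_mul_left]
        rw [ENNReal.tsum_comm]
        refine tsum_congr fun z => ?_
        have h1 := tsum_prodLaw_injective (PMF.uniformOfFintype (F → Fin M)) ht
          fun i f => C i (z i.succ) f
        rw [← h1, ← ENNReal.tsum_mul_left]
        refine tsum_congr fun h => ?_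
        rw [binningLaw]
        ring
    _ ≤ ∑' z : Fin (r + 1) → A, (∏ i, ((M : ℝ≥0∞)⁻¹ * (θ i)⁻¹)) * (PMF.pure a₀ (z 0) *
        ∏ i, k i (z i.castSucc) (z i.succ)) := by
        refine ENNReal.tsum_le_tsum fun z => ?_
        have h1 : ∏ i, ∑' f, PMF.uniformOfFintype (F → Fin M) f * C i (z i.succ) f ≤
            ∏ _i : Fin r, (M : ℝ≥0∞)⁻¹ := Finset.prod_le_prod' fun i _ => hC i _
        refine (mul_le_mul_right h1 _).trans (le_of_eq ?_)
        simp only [Finset.prod_mul_distrib]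
        ring
    _ = _ := by rw [ENNReal.tsum_mul_left, tsum_kernel_chain_eq_one, mul_one]

theorem exists_le_of_tsum_le {C : Type*} (q : PMF C) {f : C → ℝ≥0∞} {c : ℝ≥0∞}
    (h : ∑' a, q a * f a ≤ c) : ∃ a, f a ≤ c := by
  by_contra! hlt
  obtain ⟨a, ha⟩ := q.support_nonempty
  have hc : c ≠ ⊤ := ne_top_of_lt (hlt a)
  have h1 : ∑' a, q a * c = c := by rw [ENNReal.tsum_mul_right, q.tsum_coe, one_mul]
  have h2 := ENNReal.tsum_lt_tsum (i := a) (h1.trans_ne hc)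
    (fun a => mul_le_mul_right (hlt a).le (q a))
    ((ENNReal.mul_lt_mul_iff_right ((q.mem_support_iff a).1 ha) (q.apply_ne_top a)).2 (hlt a))
  exact (lt_irrefl _) (h2.trans_le (h.trans h1.ge))

end

/-! ### The binning code -/

section

/-- The states are in `F`, and all transition probabilities are at least as large as is typical. -/
def IsTypical {A : Type*} (F : Finset A) (K : ℕ → A → PMF A) (θ : ℕ → ℝ≥0∞) {m : ℕ}
    (x : Fin m → A) : Prop :=
  (∀ v, x v ∈ F) ∧ ∀ u v : Fin m, u < v → θ (v - u) ≤ K (v - u) (x u) (x v)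

/-- The index of the `k`-th state that is not hit by the burst. -/
def skipBurst (j b k : ℕ) : ℕ := if k ≤ j then k else k + b

theorem skipBurst_lt {j b k l : ℕ} (h : k < l) : skipBurst j b k < skipBurst j b l := by
  unfold skipBurst
  split_ifs <;> omega

variable {S : Type*} {n : ℕ}

/-- The state at time `s`, for `s` inside the horizon. -/
def stateAt {A : Type*} {m : ℕ} (x : Fin (m + 1) → A) (s : ℕ) : A := x ⟨min s m, by omega⟩

theorem stateAt_of_le {A : Type*} {m : ℕ} (x : Fin (m + 1) → A) {s : ℕ} (h : s ≤ m) :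
    stateAt x s = x ⟨s, by omega⟩ := congrArg x (Fin.ext (min_eq_left h))

/-- The time of the `k`-th channel output that is not erased. -/
def sentTime (L j b k : ℕ) : Fin (L + 1) := ⟨min (skipBurst j b k - 1) L, by omega⟩

theorem sentTime_injective {L j b l r : ℕ} (h : skipBurst j b (l + r) ≤ L + 1) :
    Function.Injective fun i : Fin r => sentTime L j b (l + i + 1) := by
  intro i i' hi
  have h1 : min (skipBurst j b (l + i + 1) - 1) L = min (skipBurst j b (l + i' + 1) - 1) L :=
    congrArg Fin.val hi
  have := i.isLt
  have := i'.isLt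
  refine Fin.ext ?_
  unfold skipBurst at h h1
  split_ifs at h h1 <;> omega

open Classical in
/-- The code that sends the bin of the current source vector. The decoder looks for a typical
sequence that agrees with all channel outputs. -/
noncomputable def binningCode {L M : ℕ} [NeZero M] (F : Finset (Fin n → S))
    (K : ℕ → (Fin n → S) → PMF (Fin n → S)) (θ : ℕ → ℝ≥0∞) (h : Fin (L + 1) → F → Fin M) :
    Code S n M L where
  enc i x := binOf (h i) (x (Fin.last _))
  dec i g x₀ := if H : ∃ y : Fin (i.val + 2) → Fin n → S, (y 0 = x₀ ∧ IsTypical F K θ y) ∧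
      ∀ k, ∀ m, g k = some m → binOf (h (Fin.castLE (by omega) k)) (y k.succ) = m
    then H.choose (Fin.last _) else x₀

theorem IsTypical.castLE {A : Type*} {F : Finset A} {K : ℕ → A → PMF A} {θ : ℕ → ℝ≥0∞} {m m' : ℕ}
    {x : Fin m → A} (hx : IsTypical F K θ x) (h : m' ≤ m) :
    IsTypical F K θ fun i : Fin m' => x (Fin.castLE h i) :=
  ⟨fun _ => hx.1 _, fun u v huv => hx.2 (Fin.castLE h u) (Fin.castLE h v) huv⟩

/-- A typical true sequence is itself a candidate, so the search succeeds and a wrong output comes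
from a competing candidate. -/
theorem exists_of_recon_ne {L M : ℕ} [NeZero M] {F : Finset (Fin n → S)}
    {K : ℕ → (Fin n → S) → PMF (Fin n → S)} {θ : ℕ → ℝ≥0∞} {h : Fin (L + 1) → F → Fin M}
    {x : Fin (L + 2) → Fin n → S} (hx : IsTypical F K θ x) {j b : ℕ} {i : Fin (L + 1)}
    (hne : (binningCode F K θ h).recon x j b i ≠ x i.succ) :
    ∃ y : Fin (i.val + 2) → Fin n → S, y 0 = x 0 ∧ IsTypical F K θ y ∧
      (∀ k : Fin (i.val + 1), ¬ (j ≤ k.val ∧ k.val < j + b) →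
        binOf (h (Fin.castLE (by omega) k)) (y k.succ) =
          binOf (h (Fin.castLE (by omega) k)) (x (Fin.castLE (by omega) k.succ))) ∧
      y (Fin.last _) ≠ x i.succ := by
  have H : ∃ y : Fin (i.val + 2) → Fin n → S, (y 0 = x 0 ∧ IsTypical F K θ y) ∧
      ∀ k : Fin (i.val + 1), ∀ m,
        (binningCode F K θ h).received x j b (Fin.castLE (by omega) k) = some m →
          binOf (h (Fin.castLE (by omega) k)) (y k.succ) = m := by
    refine ⟨fun k => x (Fin.castLE (by omega) k), ⟨rfl, hx.castLE (by omega)⟩, fun k m hm => ?_⟩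
    rw [Code.received] at hm
    split_ifs at hm
    exact Option.some.inj hm
  have hrec : (binningCode F K θ h).recon x j b i = H.choose (Fin.last _) := dif_pos H
  refine ⟨H.choose, H.choose_spec.1.1, H.choose_spec.1.2, fun k hk => ?_, hrec ▸ hne⟩
  refine H.choose_spec.2 k _ ?_
  rw [Code.received]
  exact if_neg hk

/-- Among the states that are not hit by the burst, the ones with the indices `l + 1, …, l + r` can be
confused with wrong ones. -/
def Confusable {A : Type*} {L M : ℕ} [NeZero M] (F : Finset A) (K : ℕ → A → PMF A)
    (θ : ℕ → ℝ≥0∞) (h : Fin (L + 1) → F → Fin M) (x : Fin (L + 2) → A) (j b l r : ℕ) : Prop :=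
  ∃ z : Fin (r + 1) → A, z 0 = stateAt x (skipBurst j b l) ∧ ∀ i : Fin r,
    (z i.succ ∈ F ∧ stateAt x (skipBurst j b (l + i + 1)) ∈ F ∧
      z i.succ ≠ stateAt x (skipBurst j b (l + i + 1)) ∧
      binOf (h (sentTime L j b (l + i + 1))) (z i.succ) =
        binOf (h (sentTime L j b (l + i + 1))) (stateAt x (skipBurst j b (l + i + 1)))) ∧
    θ (skipBurst j b (l + i + 1) - skipBurst j b (l + i)) ≤
      K (skipBurst j b (l + i + 1) - skipBurst j b (l + i)) (z i.castSucc) (z i.succ)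

/-- The bursts `(j, b)` and the runs `(l, r)` of wrong states that matter. -/
def runs (B W L : ℕ) : Finset (ℕ × ℕ × ℕ × ℕ) :=
  (Finset.range (L + 2) ×ˢ Finset.range (B + 1) ×ˢ Finset.range (L + 2) ×ˢ
    Finset.range (L + 2)).filter fun q =>
      (q.2.2.1 + q.2.2.2 ≤ q.1 ∨ q.1 + W + 1 ≤ q.2.2.1 + q.2.2.2) ∧ 0 < q.2.2.2 ∧
        skipBurst q.1 q.2.1 (q.2.2.1 + q.2.2.2) ≤ L + 1

/-- The competitor is cut at its last agreement with the truth before the decoded state, among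
unerased states. What follows is a run of wrong states with colliding bins. Typicality was imposed
on all pairs of times, so it also controls the jump over the burst. -/
theorem exists_confusable {L M B W : ℕ} [NeZero M] {F : Finset (Fin n → S)}
    {K : ℕ → (Fin n → S) → PMF (Fin n → S)} {θ : ℕ → ℝ≥0∞} {h : Fin (L + 1) → F → Fin M}
    {x : Fin (L + 2) → Fin n → S} (hx : IsTypical F K θ x) {j b : ℕ} {i : Fin (L + 1)}
    (hj : j ≤ L + 1) (hb : b ≤ B) (hi : i.val < j ∨ j + b + W ≤ i.val)
    (hne : (binningCode F K θ h).recon x j b i ≠ x i.succ) :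
    ∃ q ∈ runs B W L, Confusable F K θ h x q.1 q.2.1 q.2.2.1 q.2.2.2 := by
  classical
  obtain ⟨y, hy0, hy, hbin, hyl⟩ := exists_of_recon_ne hx hne
  have hiL := i.isLt
  -- The rank m of the decoded state among the unerased ones; time i has state index i + 1, which
  -- moves the recovery condition to j + W + 1.
  obtain ⟨m, hm, hmj⟩ : ∃ m, skipBurst j b m = i.val + 1 ∧ (m ≤ j ∨ j + W + 1 ≤ m) := by
    unfold skipBurst
    rcases hi with hi | hi
    · exact ⟨i + 1, by rw [if_pos (by omega)], Or.inl hi⟩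
    · exact ⟨i + 1 - b, by rw [if_neg (by omega)]; omega, Or.inr (by omega)⟩
  let Q : ℕ → Prop := fun k => stateAt y (skipBurst j b k) = stateAt x (skipBurst j b k)
  have hQ0 : Q 0 := hy0
  have hQm : ¬ Q m := by
    intro hQ
    simp only [Q, hm] at hQ
    rw [stateAt_of_le y le_rfl, stateAt_of_le x (by omega)] at hQ
    exact hyl hQ
  set l := Nat.findGreatest Q m with hl
  have hQl : Q l := Nat.findGreatest_spec (Nat.zero_le m) hQ0
  have hlm : l < m := lt_of_le_of_ne (Nat.findGreatest_le m) fun h => hQm (h ▸ hQl)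
  have hmle : m ≤ skipBurst j b m := by unfold skipBurst; split_ifs <;> omega
  refine ⟨(j, b, l, m - l), ?_, fun k => stateAt y (skipBurst j b (l + k)), hQl, fun k => ?_⟩
  · simp only [runs, Finset.mem_filter, Finset.mem_product, Finset.mem_range]
    have h1 : l + (m - l) = m := by omega
    rw [h1]
    omega
  · have hk := k.isLt
    simp only at hk
    have hQk : ¬ Q (l + k + 1) :=
      Nat.findGreatest_is_greatest (by rw [← hl]; omega) (by omega)
    have hle : skipBurst j b (l + k + 1) ≤ i.val + 1 := by
      rw [← hm]
      rcases Nat.lt_or_ge (l + k + 1) m with h1 | h1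
      · exact (skipBurst_lt h1).le
      · rw [show l + k + 1 = m by omega]
    have hlt : skipBurst j b (l + k) < skipBurst j b (l + k + 1) := skipBurst_lt (by omega)
    have e1 : l + (k.succ : Fin _).val = l + k + 1 := by simp [add_assoc]
    have e2 : l + (k.castSucc : Fin _).val = l + k := by simp
    simp only [e1, e2]
    refine ⟨⟨hy.1 _, hx.1 _, hQk, ?_⟩, ?_⟩
    · obtain ⟨s, hs⟩ : ∃ s, skipBurst j b (l + k + 1) = s + 1 :=
        Nat.exists_eq_add_one_of_ne_zero (by omega)
      have hs1 : s < i.val + 1 := by omega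
      have h1 := hbin ⟨s, hs1⟩ (by
        simp only
        unfold skipBurst at hs
        split_ifs at hs <;> omega)
      have h2 : sentTime L j b (l + k + 1) = Fin.castLE (by omega) (⟨s, hs1⟩ : Fin (i.val + 1)) :=
        Fin.ext (by simp only [sentTime, Fin.val_castLE]; omega)
      rw [h2, hs, stateAt_of_le y (by omega), stateAt_of_le x (by omega)]
      exact h1
    · rw [stateAt_of_le y hle, stateAt_of_le y (hlt.le.trans hle)]
      exact hy.2 ⟨_, _⟩ ⟨_, _⟩ hlt

open Classical in
/-- The single-shot bound on the error probabilities of the best binning code. -/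
theorem exists_code_errorProb_le (p : PMF S) (κ : S → PMF S) (L M B W : ℕ) [NeZero M]
    (F : Finset (Fin n → S)) (K : ℕ → (Fin n → S) → PMF (Fin n → S)) (θ : ℕ → ℝ≥0∞)
    (hθ : ∀ g, θ g ≠ 0) (hθ' : ∀ g, θ g ≠ ⊤) :
    ∃ c : Code S n M L, ∀ (j b : ℕ) (i : Fin (L + 1)), b ≤ B →
      (i.val < j ∨ j + b + W ≤ i.val) → c.errorProb p κ j b i ≤
        (sourceLaw p κ n L).toOuterMeasure {x | ¬ IsTypical F K θ x} +
        ∑ q ∈ runs B W L, ∏ i : Fin q.2.2.2, ((M : ℝ≥0∞)⁻¹ *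
          (θ (skipBurst q.1 q.2.1 (q.2.2.1 + i + 1) - skipBurst q.1 q.2.1 (q.2.2.1 + i)))⁻¹) := by
  let bad : (Fin (L + 1) → F → Fin M) → (Fin (L + 2) → Fin n → S) → ℝ≥0∞ := fun h x =>
    (if IsTypical F K θ x then 0 else 1) + ∑ q ∈ runs B W L,
      if Confusable F K θ h x q.1 q.2.1 q.2.2.1 q.2.2.2 then 1 else 0
  have havg : ∑' h, binningLaw F M (L + 1) h * ∑' x, sourceLaw p κ n L x * bad h x ≤
      (sourceLaw p κ n L).toOuterMeasure {x | ¬ IsTypical F K θ x} +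
        ∑ q ∈ runs B W L, ∏ i : Fin q.2.2.2, ((M : ℝ≥0∞)⁻¹ *
          (θ (skipBurst q.1 q.2.1 (q.2.2.1 + i + 1) - skipBurst q.1 q.2.1 (q.2.2.1 + i)))⁻¹) := by
    simp only [← ENNReal.tsum_mul_left]
    rw [ENNReal.tsum_comm]
    have hx : ∀ x, ∑' h, binningLaw F M (L + 1) h * (sourceLaw p κ n L x * bad h x) ≤
        sourceLaw p κ n L x * (if IsTypical F K θ x then 0 else 1) +
        sourceLaw p κ n L x * ∑ q ∈ runs B W L, ∏ i : Fin q.2.2.2, ((M : ℝ≥0∞)⁻¹ *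
          (θ (skipBurst q.1 q.2.1 (q.2.2.1 + i + 1) -
            skipBurst q.1 q.2.1 (q.2.2.1 + i)))⁻¹) := by
      intro x
      simp only [mul_left_comm _ (sourceLaw p κ n L x), ENNReal.tsum_mul_left]
      rw [← mul_add]
      gcongr
      simp only [bad, mul_add, ENNReal.tsum_add, ENNReal.tsum_mul_right, PMF.tsum_coe, one_mul,
        Finset.mul_sum]
      gcongr
      rw [Summable.tsum_finsetSum fun _ _ => ENNReal.summable]
      refine Finset.sum_le_sum fun q hq => ?_
      simp only [runs, Finset.mem_filter] at hq
      exact tsum_collision_le F M (sentTime_injective hq.2.2.2) _ _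
        (fun i => K (skipBurst q.1 q.2.1 (q.2.2.1 + i + 1) - skipBurst q.1 q.2.1 (q.2.2.1 + i)))
        _ (fun i => hθ _) (fun i => hθ' _)
    refine (ENNReal.tsum_le_tsum hx).trans ?_
    rw [ENNReal.tsum_add, ENNReal.tsum_mul_right, PMF.tsum_coe, one_mul,
      PMF.toOuterMeasure_apply]
    gcongr with x
    by_cases hxt : IsTypical F K θ x <;> simp [hxt]
  obtain ⟨h, hh⟩ := exists_le_of_tsum_le _ havg
  refine ⟨binningCode F K θ h, fun j b i hb hi => le_trans ?_ hh⟩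
  rw [Code.errorProb, PMF.toOuterMeasure_apply]
  refine ENNReal.tsum_le_tsum fun x => Set.indicator_apply_le' (fun hx => ?_) fun _ => bot_le
  conv_lhs => rw [← mul_one (sourceLaw p κ n L x)]
  gcongr
  by_cases hxt : IsTypical F K θ x
  swap
  · simp [bad, hxt]
  have hiL := i.isLt
  -- A burst that starts after the horizon erases nothing, so j may be capped; this leaves finitely
  -- many runs.
  have hx' : (binningCode F K θ h).recon x (min j (L + 1)) b i ≠ x i.succ := by
    have : (binningCode F K θ h).recon x (min j (L + 1)) b i =
        (binningCode F K θ h).recon x j b i := by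
      simp only [Code.recon, Code.received]
      congr 1
      funext k
      have hk := k.isLt
      refine if_congr ?_ rfl rfl
      simp only [Fin.val_castLE]
      omega
    rw [this]
    exact hx
  obtain ⟨q, hq, hc⟩ := exists_confusable (B := B) (W := W) hxt (min_le_right _ _) hb (by omega) hx'
  refine le_trans ?_ le_add_self
  refine le_trans ?_ (Finset.single_le_sum (fun _ _ => bot_le) hq)
  rw [if_pos hc]

end

/-! ### Achievability -/

section

variable {S : Type*} {p : PMF S} {κ : S → PMF S}

theorem exists_finset_compl_le {C : Type*} (q : PMF C) {η : ℝ≥0∞} (hη : 0 < η) :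
    ∃ s : Finset C, q.toOuterMeasure {x | x ∉ s} ≤ η := by
  have h := ENNReal.tendsto_tsum_compl_atTop_zero q.tsum_coe_ne_top
  obtain ⟨s, hs⟩ := (h.eventually (ge_mem_nhds hη)).exists
  refine ⟨s, le_trans (le_of_eq ?_) hs⟩
  rw [PMF.toOuterMeasure_apply, ← tsum_subtype]
  rfl

/-- Most of the source sequences consist of vectors in a finite set. -/
theorem exists_finset_states (q : ℕ → ℕ) {A : ℕ → Type*} (μ : ∀ n, PMF (Fin (q n) → A n)) :
    ∃ F : ∀ n, Finset (A n),
      Tendsto (fun n => (μ n).toOuterMeasure {x | ¬ ∀ v, x v ∈ F n}) atTop (𝓝 0) := by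
  classical
  have h : ∀ n : ℕ, ∃ s : Finset (Fin (q n) → A n),
      (μ n).toOuterMeasure {x | x ∉ s} ≤ ((n : ℝ≥0∞) + 1)⁻¹ := fun n =>
    exists_finset_compl_le (μ n) (ENNReal.inv_pos.2 (by finiteness))
  choose s hs using h
  -- All entries of the sequences in a finite set that carries all but 1/(n+1) of the mass.
  refine ⟨fun n => Finset.univ.biUnion fun v => (s n).image fun x => x v, ?_⟩
  have h0 : Tendsto (fun n : ℕ => ((n : ℝ≥0∞) + 1)⁻¹) atTop (𝓝 0) := by
    have := (tendsto_add_atTop_iff_nat 1).2 ENNReal.tendsto_inv_nat_nhds_zero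
    simpa using this
  refine tendsto_of_tendsto_of_tendsto_of_le_of_le tendsto_const_nhds h0 (fun _ => bot_le)
    fun n => le_trans (MeasureTheory.measure_mono fun x hx => ?_) (hs n)
  intro hxs
  exact hx fun v => Finset.mem_biUnion.2 ⟨v, Finset.mem_univ _, Finset.mem_image_of_mem _ hxs⟩

/-- The transition probabilities of the source vectors. -/
noncomputable def vectorStep (κ : S → PMF S) (n g : ℕ) (x : Fin n → S) : PMF (Fin n → S) :=
  prodLaw fun k => stepLaw κ g (x k)

/-- A typical value of the transition probabilities of the source vectors. -/
noncomputable def threshold (p : PMF S) (κ : S → PMF S) (δ : ℝ) (n g : ℕ) : ℝ≥0∞ :=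
  ENNReal.ofReal (2 ^ (-(n * (stepEntropy p κ g + δ))))

theorem tendsto_not_threshold_le [Countable S] (hstat : p.bind κ = p) (hfin : FiniteEntropy p)
    {L : ℕ} {δ : ℝ} (hδ : 0 < δ) {u v : Fin (L + 2)} (huv : u < v) :
    Tendsto (fun n => (sourceLaw p κ n L).toOuterMeasure
      {x | ¬ threshold p κ δ n (v - u) ≤ vectorStep κ n (v - u) (x u) (x v)}) atTop (𝓝 0) := by
  obtain ⟨u, hu⟩ := u
  obtain ⟨v, hv⟩ := v
  obtain ⟨g, rfl⟩ := Nat.exists_eq_add_of_le (Fin.mk_lt_mk.1 huv).le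
  simp only [Nat.add_sub_cancel_left]
  have hconc := sourceLaw_weight_concentrates (L := L)
    (w := fun y => (stepLaw κ g (y ⟨u, hu⟩) (y ⟨u + g, hv⟩)).toReal)
    (fun y hy => toReal_pos_of_ne_zero _
      (stepLaw_ne_zero_of_chainLaw hstat u g (by omega) hy))
    (hasMean_chainLaw hstat hfin (m := L + 1) u g (by omega)) hδ
  refine tendsto_of_tendsto_of_tendsto_of_le_of_le tendsto_const_nhds hconc (fun _ => bot_le)
    fun n => MeasureTheory.measure_mono fun x hx hx' => hx ?_
  refine (ENNReal.ofReal_le_ofReal hx'.1).trans (le_of_eq ?_)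
  rw [ENNReal.ofReal_prod_of_nonneg fun _ _ => ENNReal.toReal_nonneg]
  exact Finset.prod_congr rfl fun k _ => ENNReal.ofReal_toReal (PMF.apply_ne_top _ _)

theorem tendsto_not_isTypical [Countable S] (hstat : p.bind κ = p) (hfin : FiniteEntropy p)
    (L : ℕ) {δ : ℝ} (hδ : 0 < δ) :
    ∃ F : ∀ n, Finset (Fin n → S), Tendsto (fun n => (sourceLaw p κ n L).toOuterMeasure
      {x | ¬ IsTypical (F n) (vectorStep κ n) (threshold p κ δ n) x}) atTop (𝓝 0) := by
  classical
  obtain ⟨F, hF⟩ := exists_finset_states (fun _ => L + 2) fun n => sourceLaw p κ n L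
  refine ⟨F, ?_⟩
  have hsum := hF.add (tendsto_finsetSum
    ((Finset.univ : Finset (Fin (L + 2) × Fin (L + 2))).filter fun z => z.1 < z.2)
    fun z hz => tendsto_not_threshold_le hstat hfin hδ (Finset.mem_filter.1 hz).2)
  simp only [Finset.sum_const_zero, add_zero] at hsum
  refine tendsto_of_tendsto_of_tendsto_of_le_of_le tendsto_const_nhds hsum (fun _ => bot_le)
    fun n => ?_
  refine le_trans (MeasureTheory.measure_mono fun x hx => ?_)
    ((MeasureTheory.measure_union_le _ _).trans
      (add_le_add le_rfl (MeasureTheory.measure_biUnion_finset_le _ _)))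
  by_contra hx'
  simp only [Set.mem_union, Set.mem_iUnion, not_or, not_exists] at hx'
  refine hx ⟨not_not.1 hx'.1, fun u v huv => ?_⟩
  exact not_not.1 (hx'.2 (u, v) (Finset.mem_filter.2 ⟨Finset.mem_univ _, huv⟩))

theorem stepEntropy_one_le_upperBound (hstat : p.bind κ = p) (hfin : FiniteEntropy p) (B W : ℕ) :
    stepEntropy p κ 1 ≤ upperBound p κ B W := by
  rw [upperBound_eq hstat hfin]
  have h1 : stepEntropy p κ 1 ≤ stepEntropy p κ (B + 1) :=
    stepEntropy_mono hstat hfin (by omega)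
  have h2 : 0 ≤ 1 / ((W : ℝ) + 1) * (stepEntropy p κ (B + 1) - stepEntropy p κ 1) :=
    mul_nonneg (by positivity) (by linarith)
  linarith

theorem stepEntropy_nonneg (p : PMF S) (κ : S → PMF S) (g : ℕ) : 0 ≤ stepEntropy p κ g :=
  tsum_nonneg fun _ => mul_nonneg ENNReal.toReal_nonneg (neg_logb_nonneg _ _)

theorem skipBurst_gap (j b k : ℕ) :
    skipBurst j b (k + 1) - skipBurst j b k = if k = j then b + 1 else 1 := by
  unfold skipBurst
  split_ifs <;> omega

/-- The conditional entropies along a run of `r` states are at most `r` times the upper bound. -/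
theorem sum_stepEntropy_le (hstat : p.bind κ = p) (hfin : FiniteEntropy p) {B W j b l r : ℕ}
    (hb : b ≤ B) (h : l + r ≤ j ∨ j + W + 1 ≤ l + r) :
    ∑ i : Fin r, stepEntropy p κ (skipBurst j b (l + i + 1) - skipBurst j b (l + i)) ≤
      r * upperBound p κ B W := by
  simp only [skipBurst_gap]
  set H := stepEntropy p κ with hH
  have hH1 := stepEntropy_one_le_upperBound hstat hfin B W
  have hmono : H (b + 1) ≤ H (B + 1) := stepEntropy_mono hstat hfin (by omega)
  have hmono' : H 1 ≤ H (b + 1) := stepEntropy_mono hstat hfin (by omega)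
  have h1 : ∑ i : Fin r, H (if l + i = j then b + 1 else 1) =
      r * H 1 + ∑ i : Fin r, if l + i = j then H (b + 1) - H 1 else 0 := by
    have : ∀ i : Fin r, H (if l + i = j then b + 1 else 1) =
        H 1 + if l + i = j then H (b + 1) - H 1 else 0 := by
      intro i
      split_ifs <;> ring
    simp only [this, Finset.sum_add_distrib, Finset.sum_const, Finset.card_univ, Fintype.card_fin,
      nsmul_eq_mul]
  rw [h1]
  -- Only a run that crosses the burst pays the excess H_{b+1} - H_1. It ends at j + W + 1 or later
  -- and starts from l ≤ j, so r ≥ W + 1 and the excess is spread over enough states.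
  by_cases hlj : l ≤ j ∧ j < l + r
  · have h2 : (∑ i : Fin r, if l + i = j then H (b + 1) - H 1 else 0) = H (b + 1) - H 1 := by
      rw [Finset.sum_eq_single ⟨j - l, by omega⟩]
      · rw [if_pos (by simp only; omega)]
      · intro i _ hi
        rw [if_neg fun h => hi (Fin.ext (by simp only; omega))]
      · simp
    have hr : W + 1 ≤ r := by omega
    have hr' : ((W : ℝ) + 1) ≤ r := by exact_mod_cast hr
    have hW : (0 : ℝ) < (W : ℝ) + 1 := by positivity
    rw [h2, upperBound_eq hstat hfin, ← hH, mul_add, ← mul_assoc, mul_one_div]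
    have h3 : 1 ≤ (r : ℝ) / ((W : ℝ) + 1) := (one_le_div hW).2 hr'
    nlinarith
  · have h2 : (∑ i : Fin r, if l + i = j then H (b + 1) - H 1 else 0) = 0 :=
      Finset.sum_eq_zero fun i _ => if_neg fun h => hlj (by have := i.isLt; omega)
    rw [h2, add_zero]
    exact mul_le_mul_of_nonneg_left hH1 (Nat.cast_nonneg r)

theorem inv_floor_le {y : ℝ} (hy : 1 ≤ y) : ((⌊y⌋₊ : ℕ) : ℝ≥0∞)⁻¹ ≤ ENNReal.ofReal (2 * y⁻¹) := by
  have h1 : 1 ≤ ⌊y⌋₊ := Nat.le_floor (by simpa using hy)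
  have h1' : (1 : ℝ) ≤ ⌊y⌋₊ := by exact_mod_cast h1
  have h2 : y < ⌊y⌋₊ + 1 := Nat.lt_floor_add_one y
  have h3 : (0 : ℝ) < y := by linarith
  rw [← ENNReal.ofReal_natCast, ← ENNReal.ofReal_inv_of_pos (by linarith)]
  refine ENNReal.ofReal_le_ofReal ?_
  rw [← div_eq_mul_inv, inv_eq_one_div, div_le_div_iff₀ (by linarith) h3]
  linarith

theorem tendsto_two_rpow_neg {δ : ℝ} (hδ : 0 < δ) (C : ℝ) :
    Tendsto (fun n : ℕ => ENNReal.ofReal (C * 2 ^ (-(n * δ)))) atTop (𝓝 0) := by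
  have h1 : Tendsto (fun n : ℕ => C * ((2 : ℝ) ^ (-δ)) ^ n) atTop (𝓝 (C * 0)) :=
    (tendsto_pow_atTop_nhds_zero_of_lt_one (by positivity)
      (Real.rpow_lt_one_of_one_lt_of_neg one_lt_two (by linarith))).const_mul C
  have h2 := ENNReal.tendsto_ofReal h1
  rw [mul_zero, ENNReal.ofReal_zero] at h2
  refine h2.congr fun n => ?_
  rw [← Real.rpow_natCast, ← Real.rpow_mul two_pos.le]
  ring_nf

/-- Only the sum of the exponents has to be positive, so the long gap may exceed R on its own. The
floors cost a constant 2^r. -/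
theorem tendsto_prod_threshold {R δ : ℝ} (hR : 0 ≤ R) {r : ℕ} (g : Fin r → ℕ)
    (h : 0 < ∑ i, (R - (stepEntropy p κ (g i) + δ))) :
    Tendsto (fun n : ℕ => ∏ i, (((⌊(2 : ℝ) ^ ((n : ℝ) * R)⌋₊ : ℕ) : ℝ≥0∞)⁻¹ *
      (threshold p κ δ n (g i))⁻¹)) atTop (𝓝 0) := by
  refine tendsto_of_tendsto_of_tendsto_of_le_of_le tendsto_const_nhds
    (tendsto_two_rpow_neg h (2 ^ r)) (fun _ => bot_le) fun n => ?_
  have h1 : ∀ i, ((⌊(2 : ℝ) ^ ((n : ℝ) * R)⌋₊ : ℕ) : ℝ≥0∞)⁻¹ * (threshold p κ δ n (g i))⁻¹ ≤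
      ENNReal.ofReal (2 * 2 ^ (-(n * (R - (stepEntropy p κ (g i) + δ))))) := by
    intro i
    refine (mul_le_mul_left (inv_floor_le
      (Real.one_le_rpow one_le_two (by positivity))) _).trans (le_of_eq ?_)
    rw [threshold, ← ENNReal.ofReal_inv_of_pos (by positivity),
      ← ENNReal.ofReal_mul (by positivity), ← Real.rpow_neg two_pos.le,
      ← Real.rpow_neg two_pos.le, mul_assoc, ← Real.rpow_add two_pos]
    ring_nf
  refine (Finset.prod_le_prod' fun i _ => h1 i).trans (le_of_eq ?_)
  rw [← ENNReal.ofReal_prod_of_nonneg fun _ _ => by positivity, Finset.prod_mul_distrib,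
    prod_two_rpow, Finset.sum_neg_distrib, Finset.mul_sum]
  simp

theorem feasible_of_upperBound_lt [Countable S] (hstat : p.bind κ = p) (hfin : FiniteEntropy p)
    {B W : ℕ} (L : ℕ) {R : ℝ} (hR : upperBound p κ B W < R) : Feasible p κ B W L R := by
  -- Half of the excess rate pays for typicality, and a run of length r keeps an exponent of at
  -- least rδ.
  set δ := (R - upperBound p κ B W) / 2 with hδ
  have hδ0 : 0 < δ := by rw [hδ]; linarith
  have hR0 : 0 ≤ R := (stepEntropy_nonneg p κ 1).trans
    ((stepEntropy_one_le_upperBound hstat hfin B W).trans hR.le)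
  obtain ⟨F, hF⟩ := tendsto_not_isTypical hstat hfin L hδ0
  have hM : ∀ n : ℕ, NeZero ⌊(2 : ℝ) ^ ((n : ℝ) * R)⌋₊ := fun n =>
    ⟨(Nat.floor_pos.2 (Real.one_le_rpow one_le_two (by positivity))).ne'⟩
  have hcode := fun n : ℕ => exists_code_errorProb_le p κ L ⌊(2 : ℝ) ^ ((n : ℝ) * R)⌋₊ B W
    (F n) (vectorStep κ n) (threshold p κ δ n)
    (fun g => (ENNReal.ofReal_pos.2 (by positivity)).ne') (fun g => ENNReal.ofReal_ne_top)
  choose c hc using hcode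
  have hlim := hF.add (tendsto_finsetSum (runs B W L) fun q hq =>
    tendsto_prod_threshold (p := p) (κ := κ) (δ := δ) hR0
      (fun i : Fin q.2.2.2 =>
        skipBurst q.1 q.2.1 (q.2.2.1 + i + 1) - skipBurst q.1 q.2.1 (q.2.2.1 + i)) (by
      simp only [runs, Finset.mem_filter, Finset.mem_product, Finset.mem_range] at hq
      have h1 := sum_stepEntropy_le hstat hfin (B := B) (W := W) (b := q.2.1) (by omega) hq.2.1
      have h2 : (0 : ℝ) < q.2.2.2 := Nat.cast_pos.2 hq.2.2.1
      simp only [Finset.sum_sub_distrib, Finset.sum_add_distrib, Finset.sum_const,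
        Finset.card_univ, Fintype.card_fin, nsmul_eq_mul]
      have h3 : 0 < (q.2.2.2 : ℝ) * δ := mul_pos h2 hδ0
      have h4 : (q.2.2.2 : ℝ) * R = q.2.2.2 * upperBound p κ B W + 2 * (q.2.2.2 * δ) := by
        rw [hδ]; ring
      linarith))
  simp only [Finset.sum_const_zero, add_zero] at hlim
  obtain ⟨ε, hε, hcε⟩ : ∃ ε : ℕ → ℝ≥0∞, Tendsto ε atTop (𝓝 0) ∧ ∀ (n j b : ℕ) (i : Fin (L + 1)),
      b ≤ B → (i.val < j ∨ j + b + W ≤ i.val) → (c n).errorProb p κ j b i ≤ ε n := ⟨_, hlim, hc⟩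
  -- The bound is capped at 1, which loses nothing for probabilities and makes it finite for every
  -- n.
  refine ⟨c, fun n => (min 1 (ε n)).toNNReal, ?_, fun n j b i hb hi => ?_⟩
  rotate_left
  · rw [ENNReal.coe_toNNReal (ne_top_of_le_ne_top ENNReal.one_ne_top (min_le_left _ _))]
    refine le_min ?_ (hcε n j b i hb hi)
    rw [Code.errorProb]
    refine (MeasureTheory.measure_mono (Set.subset_univ _)).trans (le_of_eq ?_)
    exact (PMF.toOuterMeasure_apply_eq_one_iff _ _).2 (Set.subset_univ _)
  · have h1 := (tendsto_const_nhds (x := (1 : ℝ≥0∞)) (f := (atTop : Filter ℕ))).min hε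
    rw [min_eq_right zero_le_one] at h1
    exact (ENNReal.tendsto_toNNReal ENNReal.zero_ne_top).comp h1

end

/-! ### The limit -/

section

variable {S : Type*} {p : PMF S} {κ : S → PMF S}

theorem sourceLaw_map_init (p : PMF S) (κ : S → PMF S) (n L : ℕ) :
    (sourceLaw p κ n (L + 1)).map (fun x (i : Fin (L + 2)) => x i.castSucc) = sourceLaw p κ n L :=
  chainLaw_map_init _ _ _

/-- The code for a shorter horizon. -/
def Code.truncate {n M L : ℕ} (c : Code S n M (L + 1)) : Code S n M L where
  enc i := c.enc i.castSucc
  dec i := c.dec i.castSucc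

/-- By causality the event involves only the vectors of the shorter horizon, whose law is the
marginal. -/
theorem Code.errorProb_truncate {n M L : ℕ} (c : Code S n M (L + 1)) (j b : ℕ) (i : Fin (L + 1)) :
    c.truncate.errorProb p κ j b i = c.errorProb p κ j b i.castSucc := by
  rw [Code.errorProb, ← sourceLaw_map_init, PMF.toOuterMeasure_map_apply]
  rfl

theorem Feasible.of_succ {B W L : ℕ} {R : ℝ} (h : Feasible p κ B W (L + 1) R) :
    Feasible p κ B W L R := by
  obtain ⟨c, ε, hε, hc⟩ := h
  refine ⟨fun n => (c n).truncate, ε, hε, fun n j b i hb hi => ?_⟩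
  rw [Code.errorProb_truncate]
  exact hc n j b i.castSucc hb hi

theorem finiteRateRecovery_mono (p : PMF S) (κ : S → PMF S) (B W : ℕ) :
    Monotone fun L => finiteRateRecovery p κ B W L :=
  monotone_nat_of_le_succ fun _ => le_iInf₂ fun R hR => iInf₂_le R hR.of_succ

theorem lowerBound_le_finiteRateRecovery [Countable S] (hstat : p.bind κ = p)
    (hfin : FiniteEntropy p) (B W : ℕ) :
    (lowerBound p κ B W : EReal) ≤ finiteRateRecovery p κ B W (B + W) :=
  le_iInf₂ fun _ hR => EReal.coe_le_coe_iff.2 (lowerBound_le_of_feasible hstat hfin hR)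

theorem finiteRateRecovery_le_upperBound [Countable S] (hstat : p.bind κ = p)
    (hfin : FiniteEntropy p) (B W L : ℕ) :
    finiteRateRecovery p κ B W L ≤ (upperBound p κ B W : EReal) := by
  refine EReal.le_of_forall_lt_iff_le.1 fun R hR => ?_
  exact iInf₂_le R (feasible_of_upperBound_lt hstat hfin L (EReal.coe_lt_coe_iff.1 hR))

theorem tendsto_finiteRateRecovery (p : PMF S) (κ : S → PMF S) (B W : ℕ) :
    Tendsto (fun L => finiteRateRecovery p κ B W L) atTop (𝓝 (rateRecovery p κ B W)) := by
  have h := tendsto_atTop_iSup (finiteRateRecovery_mono p κ B W)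
  rw [rateRecovery, h.limUnder_eq]
  exact h

end

end BurstStreaming

theorem theorem1 {S : Type*} [Countable S] (p : PMF S) (κ : S → PMF S)
    (hstat : p.bind κ = p) (hfin : BurstStreaming.FiniteEntropy p) (B W : ℕ) :
    Tendsto (fun L => BurstStreaming.finiteRateRecovery p κ B W L) atTop
        (𝓝 (BurstStreaming.rateRecovery p κ B W)) ∧
      (BurstStreaming.lowerBound p κ B W : EReal) ≤ BurstStreaming.rateRecovery p κ B W ∧
      BurstStreaming.rateRecovery p κ B W ≤ (BurstStreaming.upperBound p κ B W : EReal) := by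
  have h := BurstStreaming.tendsto_finiteRateRecovery p κ B W
  refine ⟨h, ?_, le_of_tendsto' h
    fun L => BurstStreaming.finiteRateRecovery_le_upperBound hstat hfin B W L⟩
  exact (BurstStreaming.lowerBound_le_finiteRateRecovery hstat hfin B W).trans
    ((BurstStreaming.finiteRateRecovery_mono p κ B W).ge_of_tendsto h (B + W))
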